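/- **Theorem (optimal value function and optimal control).** Let $n$ be the control dimension, let $A,C\in\mathbb R$, $B\in\mathbb R^{1\times n}$, $D\in\mathbb R^{n\times n}$, $Q>0$, let $R\in\mathbb R^{n\times n}$ be symmetric positive definite, $\gamma\in(0,1)$ and $\tau>0$. Consider the scalar-state system $$x_{t+1}=(A+w^x_tC)x_t+(B+w^u_tD)u_t,\qquad t=0,1,2,\dots,$$ where $w_t^x\in\mathbb R$ and $w_t^u\in\mathbb R^{1\times n}$, the pairs $(w^x_t,w^u_t)$ are independent over time and independent of the past states and of the past and current actions, and at each time $(w_t^x,w_t^u)$ has mean zero and covariance the identity (that is, $\mathbb E[w^x_t]=0$, $\mathbb E[(w^x_t)^2]=1$, $\mathbb E[w^u_t]=0$, $\mathbb E[(w^u_t)^\top w^u_t]=I$, $\mathbb E[w^x_tw^u_t]=0$). A policy $\pi$ is a (measurable) map that assigns to each state $x\in\mathbb R$ a probability measure $\pi(\cdot|x)$ on $\mathbb R^n$; under $\pi$ the action $u_t$ is drawn from $\pi(\cdot|x_t)$. Let $\mathcal H(p)=-\int p(u)\log p(u)\,du\in[-\infty,\infty]$ denote the Shannon entropy ($-\infty$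 if there is no density). Put $$J_\pi(x)=\mathbb E_\pi\Big[\sum_{t=0}^\infty\gamma^t\big(Qx_t^2+u_t^\top Ru_t-\tau\mathcal H(\pi(\cdot|x_t))\big)\,\Big|\,x_0=x\Big]\in(-\infty,+\infty],$$ with $\infty-\infty$ counted as $+\infty$, and $J^*(x)=\inf_\pi J_\pi(x)$, the infimum being over all policies. Assume that some linear feedback has finite discounted cost, i.e. there is $K\in\mathbb R^n$ with $\gamma V_K<1$, where $V_K=A^2+C^2+K^\top(B^\top B+D^\top D)K-2ABK$. Then the algebraic Riccati equation $$P=Q+\gamma P(A^2+C^2)-(\gamma AP)^2\,B\big(R+\gamma P(B^\top B+D^\top D)\big)^{-1}B^\top$$ has a solution $P>0$, and for every such $P$, with $$K^*=\gamma\big(R+\gamma P(B^\top B+D^\top D)\big)^{-1}APB^\top,\qquad \Sigma^*=\tfrac{\tau}{2}\big(R+\gamma P(B^\top B+D^\top D)\big)^{-1},$$ $$q=\frac{\operatorname{Tr}(\Sigma^*R)+\gamma P\operatorname{Tr}\big(\Sigma^*(B^\top B+D^\top D)\big)-\frac{\tau}{2}\big(n+\log((2\pi)^n\det\Sigma^*)\big)}{1-\gamma},$$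 the matrix $\Sigma^*$ is positive definite and the following hold. 1. $J^*(x)=Px^2+q$ for all $x\in\mathbb R$. 2. The Gaussian policy $\pi^*(\cdot|x)=\mathcal N(-K^*x,\Sigma^*)$ satisfies $J_{\pi^*}(x)=J^*(x)$ for all $x$, and it is the only policy with this property. 3. $\pi^*$ minimizes $\mathbb E_{x\sim\rho}[J_\pi(x)]$ over all policies $\pi$, for every initial distribution $\rho$ on $\mathbb R$. -/

import Mathlib

open MeasureTheory ProbabilityTheory Matrix

noncomputable section

namespace EntropyLQ

/-- The action space `𝒰 = ℝⁿ`, with its Lebesgue measure `volume`. -/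
abbrev Action (n : ℕ) : Type := EuclideanSpace ℝ (Fin n)

/-- Values of the noise pair `(wˣ, wᵘ)`, with `wˣ` a scalar and `wᵘ` a row vector of length `n`. -/
abbrev Noise (n : ℕ) : Type := ℝ × (Fin n → ℝ)

/-- What happens at one time step: `(xₜ, uₜ, wₜ)` = (state, action, noise). -/
abbrev Outcome (n : ℕ) : Type := ℝ × Action n × Noise n

/-- The data of the problem. The `1 × n` matrix `B` is stored as the vector of its entries. -/
structure Model (n : ℕ) where
  A : ℝ
  C : ℝ
  B : Fin n → ℝ
  D : Matrix (Fin n) (Fin n) ℝ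
  Q : ℝ
  R : Matrix (Fin n) (Fin n) ℝ
  γ : ℝ
  τ : ℝ

/-- The moment conditions on the noise: at each time `t` the pair `(wˣ, wᵘ)`, whose law is `ν t`,
has mean zero and identity covariance. -/
structure IsWhiteNoise {n : ℕ} (ν : ℕ → Measure (Noise n)) : Prop where
  mean_x : ∀ t, ∫ w, w.1 ∂(ν t) = 0
  var_x : ∀ t, ∫ w, w.1 ^ 2 ∂(ν t) = 1
  mean_u : ∀ t i, ∫ w, w.2 i ∂(ν t) = 0
  cov_u : ∀ t i j, ∫ w, w.2 i * w.2 j ∂(ν t) = (1 : Matrix (Fin n) (Fin n) ℝ) i j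
  cov_xu : ∀ t i, ∫ w, w.1 * w.2 i ∂(ν t) = 0

/-- Admissible policies: (measurable) maps from states to probability measures on actions. -/
abbrev Policy (n : ℕ) : Type := {π : Kernel ℝ (Action n) // IsMarkovKernel π}

instance {n : ℕ} (π : Policy n) : IsMarkovKernel π.1 := π.2

/-- The Shannon (differential) entropy `-∫ p(u) log p(u) du` of a probability measure on `ℝⁿ` with
density `p`, as an extended real number; it is `-∞` if there is no density. -/
def entropy {n : ℕ} (p : Measure (Action n)) : EReal :=
  open Classical in
  if p ≪ volume then
    ((∫⁻ u, ENNReal.ofReal (Real.negMulLog (p.rnDeriv volume u).toReal) : ENNReal) : EReal)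
      - ((∫⁻ u, ENNReal.ofReal (-Real.negMulLog (p.rnDeriv volume u).toReal) : ENNReal) : EReal)
  else ⊥

/-- The law of `(x, u, w)` when `u ∼ π(·|x)` and `w` has law `ν` and is independent of `u`. -/
def outcomeKernel {n : ℕ} (π : Policy n) (ν : Measure (Noise n)) : Kernel ℝ (Outcome n) :=
  Kernel.id ×ₖ (π.1 ×ₖ Kernel.const ℝ ν)

instance {n : ℕ} (π : Policy n) (ν : Measure (Noise n)) [IsProbabilityMeasure ν] :
    IsMarkovKernel (outcomeKernel π ν) := by
  unfold outcomeKernel; infer_instance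

namespace Model

variable {n : ℕ} (m : Model n)

/-- The dynamics `xₜ₊₁ = (A + wˣ C) xₜ + (B + wᵘ D) uₜ`. -/
def next (o : Outcome n) : ℝ :=
  (m.A + o.2.2.1 * m.C) * o.1 + (m.B + o.2.2.2 ᵥ* m.D) ⬝ᵥ o.2.1.ofLp

lemma measurable_next : Measurable m.next := by
  unfold next
  simp only [dotProduct, Pi.add_apply, vecMul]
  fun_prop

/-- Conditionally on the outcomes up to time `t`, the next state is given by the dynamics, the next
action is drawn from the policy, and the next noise is drawn independently. -/
def stepKernel (ν : ℕ → Measure (Noise n)) (π : Policy n) (t : ℕ) :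
    Kernel ((i : Finset.Iic t) → Outcome n) (Outcome n) :=
  (outcomeKernel π (ν (t + 1))).comap (fun h ↦ m.next (h ⟨t, Finset.mem_Iic.2 le_rfl⟩))
    (m.measurable_next.comp (measurable_pi_apply _))

instance (ν : ℕ → Measure (Noise n)) [∀ t, IsProbabilityMeasure (ν t)] (π : Policy n) (t : ℕ) :
    IsMarkovKernel (m.stepKernel ν π t) := by
  unfold stepKernel; infer_instance

/-- The law of the trajectory `(xₜ, uₜ, wₜ)`, `t = 0, 1, 2, …`, started at `x₀ = x` and controlled
by `π`. -/
def pathLaw (ν : ℕ → Measure (Noise n)) [∀ t, IsProbabilityMeasure (ν t)] (π : Policy n) (x : ℝ) :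
    Measure (ℕ → Outcome n) :=
  Kernel.trajMeasure (X := fun _ ↦ Outcome n) (outcomeKernel π (ν 0) x) (m.stepKernel ν π)

/-- The expectation of the nonnegative terms
`∑ₜ γᵗ (Q xₜ² + uₜᵀ R uₜ + τ H⁻(π(·|xₜ)))` of the discounted cost,
`H⁻` being the negative part of the entropy. -/
def costPart (ν : ℕ → Measure (Noise n)) [∀ t, IsProbabilityMeasure (ν t)] (π : Policy n) (x : ℝ) :
    ENNReal :=
  ∫⁻ ω, ∑' t : ℕ, ENNReal.ofReal (m.γ ^ t) *
    (ENNReal.ofReal (m.Q * (ω t).1 ^ 2 + (ω t).2.1.ofLp ⬝ᵥ m.R *ᵥ (ω t).2.1.ofLp)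
      + ENNReal.ofReal m.τ * (-entropy (π.1 (ω t).1)).toENNReal) ∂(m.pathLaw ν π x)

/-- The expectation of `∑ₜ γᵗ τ H⁺(π(·|xₜ))`, `H⁺` being the positive part of the entropy. -/
def gainPart (ν : ℕ → Measure (Noise n)) [∀ t, IsProbabilityMeasure (ν t)] (π : Policy n) (x : ℝ) :
    ENNReal :=
  ∫⁻ ω, ∑' t : ℕ, ENNReal.ofReal (m.γ ^ t) *
    (ENNReal.ofReal m.τ * (entropy (π.1 (ω t).1)).toENNReal) ∂(m.pathLaw ν π x)

/-- `J_π(x) = 𝔼_π [∑ₜ γᵗ (Q xₜ² + uₜᵀ R uₜ - τ H(π(·|xₜ))) | x₀ = x]`, as an extended real number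
(for `Q, γ, τ ≥ 0` and `R` positive semidefinite). As usual for a cost, the indeterminate `∞ - ∞`
counts as `+∞`: since the entropy grows only logarithmically with the second moment, an infinite
positive part of the entropy term forces an infinite quadratic cost. -/
def value (ν : ℕ → Measure (Noise n)) [∀ t, IsProbabilityMeasure (ν t)] (π : Policy n) (x : ℝ) :
    EReal :=
  open Classical in
  if m.gainPart ν π x = ⊤ then ⊤
  else (m.costPart ν π x : EReal) - (m.gainPart ν π x : EReal)

/-- The optimal value function `J*(x)`, the infimum of `J_π(x)` over all policies. -/
def optValue (ν : ℕ → Measure (Noise n)) [∀ t, IsProbabilityMeasure (ν t)] (x : ℝ) : EReal :=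
  ⨅ π : Policy n, m.value ν π x

/-- The objective functional `𝔼_{x ∼ ρ} [J_π(x)]` for an initial distribution `ρ`. -/
def objective (ν : ℕ → Measure (Noise n)) [∀ t, IsProbabilityMeasure (ν t)] (ρ : Measure ℝ)
    (π : Policy n) : EReal :=
  ((∫⁻ x, (m.value ν π x).toENNReal ∂ρ : ENNReal) : EReal)
    - ((∫⁻ x, (-m.value ν π x).toENNReal ∂ρ : ENNReal) : EReal)

/-- `V_K = A² + C² + Kᵀ (BᵀB + DᵀD) K - 2 A B K`, the factor by which the linear feedback `u = -K x`
multiplies the second moment of the state in one step. -/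
def secondMomentFactor (K : Fin n → ℝ) : ℝ :=
  m.A ^ 2 + m.C ^ 2 + K ⬝ᵥ (vecMulVec m.B m.B + m.Dᵀ * m.D) *ᵥ K - 2 * m.A * (m.B ⬝ᵥ K)

/-- `R + γ P (BᵀB + DᵀD)`. -/
def hess (P : ℝ) : Matrix (Fin n) (Fin n) ℝ :=
  m.R + (m.γ * P) • (vecMulVec m.B m.B + m.Dᵀ * m.D)

/-- The algebraic Riccati equation
`P = Q + γ P (A² + C²) - (γ A P)² B (R + γ P (BᵀB + DᵀD))⁻¹ Bᵀ`. -/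
def SolvesARE (P : ℝ) : Prop :=
  P = m.Q + m.γ * P * (m.A ^ 2 + m.C ^ 2)
    - (m.γ * m.A * P) ^ 2 * (m.B ⬝ᵥ (m.hess P)⁻¹ *ᵥ m.B)

/-- `K* = γ (R + γ P (BᵀB + DᵀD))⁻¹ A P Bᵀ`. -/
def optGain (P : ℝ) : Fin n → ℝ := (m.γ * m.A * P) • ((m.hess P)⁻¹ *ᵥ m.B)

/-- `Σ* = (τ / 2) (R + γ P (BᵀB + DᵀD))⁻¹`. -/
def optCov (P : ℝ) : Matrix (Fin n) (Fin n) ℝ := (m.τ / 2) • (m.hess P)⁻¹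

/-- The constant term `q` of the optimal value function. -/
def optConst (P : ℝ) : ℝ :=
  ((m.optCov P * m.R).trace
      + m.γ * P * (m.optCov P * (vecMulVec m.B m.B + m.Dᵀ * m.D)).trace
      - m.τ / 2 * (n + Real.log ((2 * Real.pi) ^ n * (m.optCov P).det))) / (1 - m.γ)

end Model

end EntropyLQ

end

/-! The proof is a verification argument in which every loss is a relative entropy. Let `g_y` be the
density of `𝒩(-K* y, Σ*)`. Completing the square in `u` and using the Riccati equation for the
coefficient of `y²` gives (`stage_add_nextSq`) `Q y² + uᵀRu + γ P 𝔼[xₜ₊₁² | y, u] = P y² + (1 - γ) q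
- τ log g_y(u)`. Integrating against an action law `p` and subtracting `τ H(p)`, the defect in the
Bellman equation at `y` is `τ` times the relative entropy of `p` with respect to `𝒩(-K* y, Σ*)`. By
Gibbs' inequality it is nonnegative, and it vanishes only for that Gaussian (`bellmanValue_le`).

Along a trajectory the discounted defects telescope: when the cost and gain parts are finite,
`J_π(x) - (P x² + q) = ∑ₜ γᵗ 𝔼[gap(xₜ)]` (`hasSum_bellmanGap`). No boundary term survives, because
`Q > 0` bounds `∑ γᵗ 𝔼[xₜ²]` by the cost. The lower bound follows. Equality at `x` kills the term `t
= 0`, which is the gap at `x` itself since `x₀ = x`; hence the policy is determined at every state,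
not just almost everywhere.

The Riccati equation is solved by the intermediate value theorem, the stabilizing feedback giving an
upper barrier.

Costs and gains are kept as two separate nonnegative extended quantities, so that Tonelli applies
freely; `q`, whose sign is unknown, is split between the two sides. Real subtraction is used only
after finiteness is known. -/

namespace EntropyLQ

open scoped ENNReal

/-! ### Trajectory law and state marginals -/

lemma _root_.ProbabilityTheory.Kernel.map_eval_zero_trajMeasure {X : ℕ → Type*}
    [∀ n, MeasurableSpace (X n)] (μ₀ : Measure (X 0)) [IsProbabilityMeasure μ₀]
    (κ : (n : ℕ) → Kernel ((i : Finset.Iic n) → X i) (X (n + 1))) [∀ n, IsMarkovKernel (κ n)] :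
    (Kernel.trajMeasure μ₀ κ).map (fun ω ↦ ω 0) = μ₀ := by
  have h : (Kernel.trajMeasure μ₀ κ).map (Preorder.frestrictLe 0)
      = μ₀.map (MeasurableEquiv.piUnique (fun i : Finset.Iic 0 ↦ X i)).symm := by
    rw [Kernel.trajMeasure, Measure.map_comp _ _ (by fun_prop), Kernel.traj_map_frestrictLe,
      Kernel.partialTraj_self, Measure.id_comp]
    rfl
  have hg : Measurable fun y : (i : Finset.Iic 0) → X i ↦ y ⟨0, Finset.mem_Iic.2 le_rfl⟩ :=
    measurable_pi_apply _
  have h2 := congrArg (Measure.map (fun y : (i : Finset.Iic 0) → X i ↦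
    y ⟨0, Finset.mem_Iic.2 le_rfl⟩)) h
  rw [Measure.map_map hg (by fun_prop)] at h2
  refine h2.trans (Eq.trans (Measure.map_map hg (MeasurableEquiv.measurable _)) ?_)
  exact Measure.map_id

variable {n : ℕ}

lemma lintegral_outcomeKernel (π : Policy n) (ν : Measure (Noise n)) [IsProbabilityMeasure ν]
    (y : ℝ) {f : Outcome n → ℝ≥0∞} (hf : Measurable f) :
    ∫⁻ o, f o ∂(outcomeKernel π ν y) = ∫⁻ u, ∫⁻ w, f (y, u, w) ∂ν ∂(π.1 y) := by
  unfold outcomeKernel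
  rw [Kernel.prod_apply, Kernel.id_apply, Kernel.prod_apply, Kernel.const_apply,
    lintegral_prod _ hf.aemeasurable, lintegral_dirac' _ (by fun_prop),
    lintegral_prod _ (by fun_prop)]

lemma lintegral_outcomeKernel_fst (π : Policy n) (ν : Measure (Noise n)) [IsProbabilityMeasure ν]
    (y : ℝ) {f : ℝ → ℝ≥0∞} (hf : Measurable f) :
    ∫⁻ o, f o.1 ∂(outcomeKernel π ν y) = f y := by
  rw [lintegral_outcomeKernel π ν y (f := fun o ↦ f o.1) (by fun_prop)]
  simp

namespace Model

variable (m : Model n) (ν : ℕ → Measure (Noise n)) [∀ t, IsProbabilityMeasure (ν t)]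
  (π : Policy n) (x : ℝ)

instance : IsProbabilityMeasure (m.pathLaw ν π x) := by
  unfold pathLaw; infer_instance

lemma lintegral_pathLaw_zero {f : Outcome n → ℝ≥0∞} (hf : Measurable f) :
    ∫⁻ ω, f (ω 0) ∂(m.pathLaw ν π x) = ∫⁻ o, f o ∂(outcomeKernel π (ν 0) x) := by
  conv_rhs => rw [← Kernel.map_eval_zero_trajMeasure (X := fun _ ↦ Outcome n)
    (outcomeKernel π (ν 0) x) (m.stepKernel ν π)]
  rw [lintegral_map hf (by fun_prop), pathLaw]

lemma lintegral_pathLaw_succ (t : ℕ) {f : Outcome n → ℝ≥0∞} (hf : Measurable f) :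
    ∫⁻ ω, f (ω (t + 1)) ∂(m.pathLaw ν π x)
      = ∫⁻ ω, ∫⁻ o, f o ∂(outcomeKernel π (ν (t + 1)) (m.next (ω t))) ∂(m.pathLaw ν π x) := by
  have h := Kernel.map_frestrictLe_trajMeasure_compProd_eq_map_trajMeasure
    (X := fun _ ↦ Outcome n) (μ₀ := outcomeKernel π (ν 0) x) (κ := m.stepKernel ν π) (a := t)
  have h2 := congrArg (fun μ ↦ ∫⁻ p, f p.2 ∂μ) h
  rw [lintegral_map (by fun_prop) (by fun_prop), Measure.lintegral_compProd (by fun_prop),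
    lintegral_map (Measurable.lintegral_kernel (by fun_prop)) (by fun_prop)] at h2
  exact h2.symm

/-- The law of the state at time `t`. -/
noncomputable def stateLaw (t : ℕ) : Measure ℝ := (m.pathLaw ν π x).map (fun ω ↦ (ω t).1)

lemma lintegral_stateLaw (t : ℕ) {f : ℝ → ℝ≥0∞} (hf : Measurable f) :
    ∫⁻ y, f y ∂(m.stateLaw ν π x t) = ∫⁻ ω, f (ω t).1 ∂(m.pathLaw ν π x) :=
  lintegral_map hf (by fun_prop)

lemma stateLaw_zero : m.stateLaw ν π x 0 = Measure.dirac x := by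
  refine Measure.ext_of_lintegral _ fun f hf ↦ ?_
  rw [lintegral_stateLaw _ _ _ _ _ hf, lintegral_dirac' _ hf,
    m.lintegral_pathLaw_zero ν π x (f := fun o ↦ f o.1) (by fun_prop),
    lintegral_outcomeKernel_fst _ _ _ hf]

instance (t : ℕ) : IsProbabilityMeasure (m.stateLaw ν π x t) :=
  Measure.isProbabilityMeasure_map (Measurable.aemeasurable (by fun_prop))

lemma lintegral_pathLaw_next (t : ℕ) {f : ℝ → ℝ≥0∞} (hf : Measurable f) :
    ∫⁻ ω, f (m.next (ω t)) ∂(m.pathLaw ν π x) = ∫⁻ y, f y ∂(m.stateLaw ν π x (t + 1)) := by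
  rw [lintegral_stateLaw _ _ _ _ _ hf,
    m.lintegral_pathLaw_succ ν π x t (f := fun o ↦ f o.1) (by fun_prop)]
  exact lintegral_congr fun ω ↦ (lintegral_outcomeKernel_fst _ _ _ hf).symm

/-- Reduces every expectation at time `t` to the state marginal: given the state, the action and the
noise are independent draws, whether the outcome comes from the initial law or from a step kernel.
-/
lemma lintegral_pathLaw_eval (t : ℕ) {f : Outcome n → ℝ≥0∞} (hf : Measurable f) :
    ∫⁻ ω, f (ω t) ∂(m.pathLaw ν π x)
      = ∫⁻ y, ∫⁻ u, ∫⁻ w, f (y, u, w) ∂(ν t) ∂(π.1 y) ∂(m.stateLaw ν π x t) := by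
  have hk : Measurable fun y ↦ ∫⁻ o, f o ∂(outcomeKernel π (ν t) y) :=
    Measurable.lintegral_kernel hf
  simp_rw [← lintegral_outcomeKernel π (ν t) _ hf]
  cases t with
  | zero => rw [lintegral_pathLaw_zero _ _ _ _ hf, stateLaw_zero, lintegral_dirac' _ hk]
  | succ t => rw [lintegral_pathLaw_succ _ _ _ _ _ hf, ← lintegral_pathLaw_next _ _ _ _ _ hk]

lemma lintegral_stateLaw_succ (t : ℕ) {f : ℝ → ℝ≥0∞} (hf : Measurable f) :
    ∫⁻ y, f y ∂(m.stateLaw ν π x (t + 1))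
      = ∫⁻ y, ∫⁻ u, ∫⁻ w, f (m.next (y, u, w)) ∂(ν t) ∂(π.1 y) ∂(m.stateLaw ν π x t) := by
  rw [← lintegral_pathLaw_next _ _ _ _ _ hf]
  exact m.lintegral_pathLaw_eval ν π x t (f := fun o ↦ f (m.next o)) (hf.comp m.measurable_next)

end Model
end EntropyLQ

namespace EntropyLQ

open scoped ENNReal

/-! ### Gibbs' inequality -/

section Gibbs

variable {α : Type*} [MeasurableSpace α] {μ p : Measure α}

/-- This is `log s ≤ s - 1` at `s = g / f`, multiplied by `f`; the case `f = 0` rests on `0 log 0 =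
0`. -/
lemma negMulLog_add_mul_log_le {f g : ℝ} (hf : 0 ≤ f) (hg : 0 < g) :
    Real.negMulLog f + f * Real.log g ≤ g - f := by
  rcases hf.eq_or_lt with rfl | hf
  · simpa using hg.le
  have h := Real.log_le_sub_one_of_pos (div_pos hg hf)
  rw [Real.log_div hg.ne' hf.ne'] at h
  have h2 := mul_le_mul_of_nonneg_left h hf.le
  have h3 : f * (g / f - 1) = g - f := by field_simp
  rw [h3] at h2
  rw [Real.negMulLog]
  linarith

lemma eq_of_negMulLog_add_mul_log_eq {f g : ℝ} (hf : 0 ≤ f) (hg : 0 < g)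
    (h : Real.negMulLog f + f * Real.log g = g - f) : f = g := by
  rcases hf.eq_or_lt with rfl | hf
  · simp at h; exact h
  by_contra hne
  have h1 : g / f ≠ 1 := fun h1 ↦ hne ((div_eq_one_iff_eq hf.ne').1 h1).symm
  have h := Real.log_lt_sub_one_of_pos (div_pos hg hf) h1
  rw [Real.log_div hg.ne' hf.ne'] at h
  have h2 := mul_lt_mul_of_pos_left h hf
  have h3 : f * (g / f - 1) = g - f := by field_simp
  rw [h3] at h2
  rw [Real.negMulLog] at *
  linarith

variable [SigmaFinite μ] [IsProbabilityMeasure p]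

/-- Gibbs' inequality with its equality case, for a probability measure `p` and a positive
probability density `g`. -/
lemma integral_negMulLog_rnDeriv_add_le (hp : p ≪ μ) {g : α → ℝ} (hgm : Measurable g)
    (hg : ∀ a, 0 < g a) [hN : IsProbabilityMeasure (μ.withDensity fun a ↦ ENNReal.ofReal (g a))]
    (hH : Integrable (fun a ↦ Real.negMulLog (p.rnDeriv μ a).toReal) μ)
    (hlog : Integrable (fun a ↦ Real.log (g a)) p) :
    ∫ a, Real.negMulLog (p.rnDeriv μ a).toReal ∂μ + ∫ a, Real.log (g a) ∂p ≤ 0 ∧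
    (∫ a, Real.negMulLog (p.rnDeriv μ a).toReal ∂μ + ∫ a, Real.log (g a) ∂p = 0 →
      p = μ.withDensity fun a ↦ ENNReal.ofReal (g a)) := by
  have hgl : ∫⁻ a, ENNReal.ofReal (g a) ∂μ = 1 := by
    have := hN.measure_univ
    rwa [withDensity_apply _ MeasurableSet.univ, setLIntegral_univ] at this
  have hgi : Integrable g μ := by
    refine ⟨hgm.aestronglyMeasurable, ?_⟩
    rw [hasFiniteIntegral_iff_ofReal (.of_forall fun a ↦ (hg a).le), hgl]
    exact ENNReal.one_lt_top
  have hg1 : ∫ a, g a ∂μ = 1 := by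
    rw [integral_eq_lintegral_of_nonneg_ae (.of_forall fun a ↦ (hg a).le)
      hgm.aestronglyMeasurable, hgl, ENNReal.toReal_one]
  have hfi : Integrable (fun a ↦ (p.rnDeriv μ a).toReal) μ := Measure.integrable_toReal_rnDeriv
  have hf1 : ∫ a, (p.rnDeriv μ a).toReal ∂μ = 1 := by
    rw [Measure.integral_toReal_rnDeriv hp]; simp
  have hfl : Integrable (fun a ↦ (p.rnDeriv μ a).toReal * Real.log (g a)) μ := by
    have := (integrable_rnDeriv_smul_iff (f := fun a ↦ Real.log (g a)) hp).2 hlog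
    simpa using this
  have hfl1 : ∫ a, (p.rnDeriv μ a).toReal * Real.log (g a) ∂μ = ∫ a, Real.log (g a) ∂p := by
    rw [← integral_rnDeriv_smul hp (f := fun a ↦ Real.log (g a))]
    simp
  -- The pointwise slack in the tangent bound. As `g` and the density of `p` both have mass one, its
  -- integral is the relative entropy of `p`.
  set d : α → ℝ := fun a ↦ (g a - (p.rnDeriv μ a).toReal)
    - (Real.negMulLog (p.rnDeriv μ a).toReal + (p.rnDeriv μ a).toReal * Real.log (g a)) with hd
  have hd0 : 0 ≤ d := fun a ↦
    sub_nonneg.2 (negMulLog_add_mul_log_le ENNReal.toReal_nonneg (hg a))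
  have hdi : Integrable d μ := (hgi.sub hfi).sub (hH.add hfl)
  have hint : ∫ a, d a ∂μ
      = -(∫ a, Real.negMulLog (p.rnDeriv μ a).toReal ∂μ + ∫ a, Real.log (g a) ∂p) := by
    have e1 : ∫ a, d a ∂μ = _ := integral_sub (hgi.sub hfi) (hH.add hfl)
    have e2 := integral_sub hgi hfi
    have e3 := integral_add hH hfl
    have e1' : ∫ a, d a ∂μ = ∫ a, (g a - (p.rnDeriv μ a).toReal) ∂μ
      - ∫ a, (Real.negMulLog (p.rnDeriv μ a).toReal + (p.rnDeriv μ a).toReal * Real.log (g a)) ∂μ :=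
      e1
    linarith
  refine ⟨?_, fun h ↦ ?_⟩
  · have := integral_nonneg (μ := μ) hd0
    linarith
  · rw [h, neg_zero, integral_eq_zero_iff_of_nonneg hd0 hdi] at hint
    conv_lhs => rw [← Measure.withDensity_rnDeriv_eq p μ hp]
    refine withDensity_congr_ae ?_
    filter_upwards [hint, p.rnDeriv_lt_top μ] with a ha hlt
    have := eq_of_negMulLog_add_mul_log_eq ENNReal.toReal_nonneg (hg a)
      (sub_eq_zero.1 ha).symm
    rw [← this, ENNReal.ofReal_toReal hlt.ne]
omit [IsProbabilityMeasure p] in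
lemma negMulLog_rnDeriv_withDensity {g : α → ℝ} (hgm : Measurable g) (hg : ∀ a, 0 < g a)
    (hlog : Integrable (fun a ↦ Real.log (g a)) (μ.withDensity fun a ↦ ENNReal.ofReal (g a))) :
    Integrable (fun a ↦ Real.negMulLog
      ((μ.withDensity fun a ↦ ENNReal.ofReal (g a)).rnDeriv μ a).toReal) μ ∧
    ∫ a, Real.negMulLog ((μ.withDensity fun a ↦ ENNReal.ofReal (g a)).rnDeriv μ a).toReal ∂μ
      = -∫ a, Real.log (g a) ∂(μ.withDensity fun a ↦ ENNReal.ofReal (g a)) := by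
  have hae : (fun a ↦ -(g a * Real.log (g a))) =ᵐ[μ] fun a ↦ Real.negMulLog
      ((μ.withDensity fun a ↦ ENNReal.ofReal (g a)).rnDeriv μ a).toReal := by
    filter_upwards [Measure.rnDeriv_withDensity μ hgm.ennreal_ofReal] with a ha
    rw [ha, ENNReal.toReal_ofReal (hg a).le, Real.negMulLog, neg_mul]
  have hgo : Measurable fun a ↦ ENNReal.ofReal (g a) := hgm.ennreal_ofReal
  have hlt : ∀ᵐ a ∂μ, ENNReal.ofReal (g a) < ∞ := .of_forall fun a ↦ ENNReal.ofReal_lt_top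
  have hi := (integrable_withDensity_iff_integrable_smul' hgo hlt).1 hlog
  rw [integral_withDensity_eq_integral_toReal_smul hgo hlt, ← integral_neg]
  simp only [ENNReal.toReal_ofReal (hg _).le, smul_eq_mul] at hi ⊢
  exact ⟨hi.neg.congr hae, (integral_congr_ae hae).symm⟩

end Gibbs

/-! ### Differential entropy -/

section Entropy

variable {n : ℕ} {p : Measure (Action n)}

lemma entropy_eq_integral (hp : p ≪ volume)
    (hH : Integrable (fun u ↦ Real.negMulLog (p.rnDeriv volume u).toReal) volume) :
    entropy p = ((∫ u, Real.negMulLog (p.rnDeriv volume u).toReal : ℝ) : EReal) := by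
  have h1 := hH.lintegral_lt_top.ne
  have h2 := hH.neg.lintegral_lt_top.ne
  simp only [Pi.neg_apply] at h2
  rw [entropy, if_pos hp, integral_eq_lintegral_pos_part_sub_lintegral_neg_part hH,
    EReal.coe_sub, EReal.coe_ennreal_toReal h1, EReal.coe_ennreal_toReal h2]

/-- In `EReal`, `⊤ - ⊤ = ⊥`. So excluding `⊥` makes the negative part finite (and forces a density),
after which excluding `⊤` makes the positive part finite. -/
lemma integrable_of_entropy_ne (hbot : entropy p ≠ ⊥) (htop : entropy p ≠ ⊤) :
    p ≪ volume ∧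
      Integrable (fun u ↦ Real.negMulLog (p.rnDeriv volume u).toReal) volume := by
  rw [entropy] at hbot htop
  split_ifs at hbot htop with hp
  · refine ⟨hp, ?_⟩
    set a := ∫⁻ u, ENNReal.ofReal (Real.negMulLog (p.rnDeriv volume u).toReal)
    set b := ∫⁻ u, ENNReal.ofReal (-Real.negMulLog (p.rnDeriv volume u).toReal) with hb
    have hbt : b ≠ ⊤ := fun h ↦ by simp [h] at hbot
    have hat : a ≠ ⊤ := fun h ↦ by
      rw [h, ← EReal.coe_ennreal_toReal hbt] at htop
      exact htop (EReal.top_sub_coe b.toReal)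
    have hm : Measurable fun u ↦ Real.negMulLog (p.rnDeriv volume u).toReal :=
      Real.continuous_negMulLog.measurable.comp (Measure.measurable_rnDeriv _ _).ennreal_toReal
    refine ⟨hm.aestronglyMeasurable, ?_⟩
    rw [hasFiniteIntegral_iff_norm]
    have : ∀ r : ℝ, ENNReal.ofReal ‖r‖ = ENNReal.ofReal r + ENNReal.ofReal (-r) := by
      intro r
      rcases le_total 0 r with h | h
      · simp [abs_of_nonneg h, ENNReal.ofReal_of_nonpos (neg_nonpos.2 h)]
      · simp [abs_of_nonpos h, ENNReal.ofReal_of_nonpos h]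
    simp_rw [this]
    rw [lintegral_add_left hm.ennreal_ofReal]
    exact ENNReal.add_lt_top.2 ⟨hat.lt_top, hbt.lt_top⟩
  · exact absurd rfl hbot

/-- A density jointly measurable in state and action is needed. Kernel Radon-Nikodym derivatives
supply one against a finite measure `g` equivalent to Lebesgue measure; the chain rule then returns
to `volume`. -/
lemma measurable_entropy (π : Policy n) : Measurable fun x ↦ entropy (π.1 x) := by
  classical
  set g : Measure (Action n) := (volume : Measure (Action n)).toFinite with hg
  have hgv : g ≪ volume := toFinite_absolutelyContinuous _
  have hvg : volume ≪ g := absolutelyContinuous_toFinite _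
  set r : ℝ → Action n → ℝ≥0∞ := fun x u ↦
    Kernel.rnDeriv π.1 (Kernel.const ℝ g) x u * g.rnDeriv volume u with hr
  have hrm : Measurable (Function.uncurry r) := by
    refine (Kernel.measurable_rnDeriv _ _).mul ?_
    exact (Measure.measurable_rnDeriv g volume).comp measurable_snd
  have hr2 : Measurable (fun q : ℝ × Action n ↦ Real.negMulLog (r q.1 q.2).toReal) :=
    Real.continuous_negMulLog.measurable.comp hrm.ennreal_toReal
  have hac : ∀ x, π.1 x ≪ volume ↔ π.1 x ≪ Kernel.const ℝ g x := fun x ↦ by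
    rw [Kernel.const_apply]
    exact ⟨fun h ↦ h.trans hvg, fun h ↦ h.trans hgv⟩
  have hrd : ∀ x, π.1 x ≪ volume → (π.1 x).rnDeriv volume =ᵐ[volume] r x := fun x hx ↦ by
    have h1 := hvg.ae_le (Kernel.rnDeriv_eq_rnDeriv_measure (κ := π.1) (η := Kernel.const ℝ g) (a := x))
    have h2 := Measure.rnDeriv_mul_rnDeriv (κ := volume) (μ := π.1 x) (ν := g) (hx.trans hvg)
    filter_upwards [h1, h2] with u h1 h2
    rw [hr, ← h2]
    simp only [Pi.mul_apply, h1, Kernel.const_apply]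
  have heq : (fun x ↦ entropy (π.1 x)) = {x | π.1 x ≪ Kernel.const ℝ g x}.piecewise
      (fun x ↦ ((∫⁻ u, ENNReal.ofReal (Real.negMulLog (r x u).toReal) : ENNReal) : EReal)
        - ((∫⁻ u, ENNReal.ofReal (-Real.negMulLog (r x u).toReal) : ENNReal) : EReal))
      (fun _ ↦ ⊥) := by
    funext x
    by_cases hx : π.1 x ≪ volume
    · rw [Set.piecewise_eq_of_mem _ _ _ ((hac x).1 hx), entropy, if_pos hx]
      congr 2
      · refine lintegral_congr_ae ?_
        filter_upwards [hrd x hx] with u hu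
        rw [hu]
      · refine lintegral_congr_ae ?_
        filter_upwards [hrd x hx] with u hu
        rw [hu]
    · have hx' : x ∉ {x | π.1 x ≪ Kernel.const ℝ g x} := fun h ↦ hx ((hac x).2 h)
      rw [Set.piecewise_eq_of_notMem _ _ _ hx', entropy, if_neg hx]
  rw [heq]
  refine Measurable.piecewise (Kernel.measurableSet_absolutelyContinuous _ _) ?_ measurable_const
  simp_rw [sub_eq_add_neg]
  refine Measurable.add ?_ (Measurable.neg ?_)
  · exact (Measurable.lintegral_prod_right' (f := fun q : ℝ × Action n ↦
      ENNReal.ofReal (Real.negMulLog (r q.1 q.2).toReal)) hr2.ennreal_ofReal).coe_ereal_ennreal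
  · exact (Measurable.lintegral_prod_right' (f := fun q : ℝ × Action n ↦
      ENNReal.ofReal (-Real.negMulLog (r q.1 q.2).toReal)) hr2.neg.ennreal_ofReal).coe_ereal_ennreal

end Entropy
end EntropyLQ

namespace EntropyLQ

open scoped ENNReal

/-! ### Gaussian densities -/

section Gaussian

variable {n : ℕ}

/-- The characteristic functions agree, by the Gaussian Fourier integral. -/
lemma stdGaussian_eq_withDensity :
    stdGaussian (Action n) = volume.withDensity fun u ↦
      ENNReal.ofReal ((√((2 * Real.pi) ^ n))⁻¹ * Real.exp (-(1 / 2) * ‖u‖ ^ 2)) := by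
  have hb : (0 : ℝ) < ((1 / 2 : ℝ) : ℂ).re := by norm_num
  have hc := GaussianFourier.integrable_cexp_neg_mul_sq_norm_add (V := Action n) hb 0 0
  have hi : Integrable fun u : Action n ↦
      (√((2 * Real.pi) ^ n))⁻¹ * Real.exp (-(1 / 2) * ‖u‖ ^ 2) := by
    refine Integrable.const_mul ?_ _
    refine hc.re.congr (.of_forall fun u ↦ ?_)
    simp only [zero_mul, add_zero]
    have : (-((1 / 2 : ℝ) : ℂ) * (‖u‖ : ℂ) ^ 2) = ((-(1 / 2) * ‖u‖ ^ 2 : ℝ) : ℂ) := by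
      push_cast; ring
    rw [this, ← Complex.ofReal_exp]
    rfl
  have := isFiniteMeasure_withDensity_ofReal hi.2
  refine Measure.ext_of_charFun ?_
  funext t
  rw [charFun_stdGaussian, charFun_apply,
    integral_withDensity_eq_integral_toReal_smul (by fun_prop)
      (.of_forall fun u ↦ ENNReal.ofReal_lt_top)]
  have h2 := GaussianFourier.integral_cexp_neg_mul_sq_norm_add (V := Action n) hb Complex.I t
  have h3 : ∀ u : Action n, (ENNReal.ofReal ((√((2 * Real.pi) ^ n))⁻¹
        * Real.exp (-(1 / 2) * ‖u‖ ^ 2))).toReal • Complex.exp (inner ℝ u t * Complex.I)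
      = ((√((2 * Real.pi) ^ n))⁻¹ : ℝ) * Complex.exp (-((1 / 2 : ℝ) : ℂ) * ‖u‖ ^ 2
        + Complex.I * inner ℝ t u) := by
    intro u
    rw [ENNReal.toReal_ofReal (by positivity), Complex.real_smul, Complex.exp_add,
      real_inner_comm u t, mul_comm Complex.I]
    push_cast
    ring
  simp_rw [h3]
  rw [integral_const_mul, h2]
  have h4 : ((Real.pi : ℂ) / ((1 / 2 : ℝ) : ℂ)) ^ ((Module.finrank ℝ (Action n) : ℂ) / 2)
      = ((√((2 * Real.pi) ^ n) : ℝ) : ℂ) := by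
    have : (Real.pi : ℂ) / ((1 / 2 : ℝ) : ℂ) = ((2 * Real.pi : ℝ) : ℂ) := by
      push_cast; field_simp
    rw [this, finrank_euclideanSpace_fin, Real.sqrt_eq_rpow, ← Real.rpow_natCast,
      ← Real.rpow_mul (by positivity)]
    rw [Complex.ofReal_cpow (by positivity)]
    push_cast
    congr 1
    ring
  rw [h4, ← mul_assoc, ← Complex.ofReal_mul, inv_mul_cancel₀ (by positivity), Complex.ofReal_one,
    one_mul, Complex.I_sq]
  congr 1
  push_cast
  ring

/-- The density of the Gaussian measure with mean `c` and covariance matrix `S`. -/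
noncomputable def gaussianDensity (c : Action n) (S : Matrix (Fin n) (Fin n) ℝ) (u : Action n) :
    ℝ :=
  (√((2 * Real.pi) ^ n * S.det))⁻¹
    * Real.exp (-(1 / 2) * ((u - c).ofLp ⬝ᵥ S⁻¹ *ᵥ (u - c).ofLp))

variable (c : Action n) {S : Matrix (Fin n) (Fin n) ℝ}

lemma measurable_gaussianDensity : Measurable (gaussianDensity c S) := by
  unfold gaussianDensity
  simp only [dotProduct, mulVec]
  fun_prop

lemma gaussianDensity_pos (hS : S.PosDef) (u : Action n) : 0 < gaussianDensity c S u := by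
  have := hS.det_pos
  unfold gaussianDensity
  positivity

lemma log_gaussianDensity (hS : S.PosDef) (u : Action n) :
    Real.log (gaussianDensity c S u) = -(1 / 2) * Real.log ((2 * Real.pi) ^ n * S.det)
      - 1 / 2 * ((u - c).ofLp ⬝ᵥ S⁻¹ *ᵥ (u - c).ofLp) := by
  have := hS.det_pos
  rw [gaussianDensity, Real.log_mul (by positivity) (by positivity), Real.log_exp, Real.log_inv,
    Real.log_sqrt (by positivity)]
  ring

open scoped MatrixOrder in
lemma _root_.Matrix.PosDef.cfcSqrt_spec {S : Matrix (Fin n) (Fin n) ℝ} (hS : S.PosDef) :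
    CFC.sqrt S * CFC.sqrt S = S ∧ (CFC.sqrt S)ᵀ = CFC.sqrt S ∧ (CFC.sqrt S).det ≠ 0 := by
  have hLL : CFC.sqrt S * CFC.sqrt S = S := CFC.sqrt_mul_sqrt_self S hS.posSemidef.nonneg
  refine ⟨hLL, ?_, fun h ↦ hS.det_pos.ne ?_⟩
  · rw [← conjTranspose_eq_transpose_of_trivial]
    exact (CFC.sqrt_nonneg S).isSelfAdjoint
  · rw [← hLL, det_mul, h, mul_zero]

open scoped MatrixOrder in
-- The measure is the image of the standard Gaussian under `u ↦ c + √S u`. The Jacobian `|det √S|`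
-- turns the standard normalization into that of `S`, and translation invariance absorbs `c`.
lemma multivariateGaussian_eq_withDensity (hS : S.PosDef) :
    multivariateGaussian c S
      = volume.withDensity fun u ↦ ENNReal.ofReal (gaussianDensity c S u) := by
  set L := CFC.sqrt S with hL
  obtain ⟨hLL, hLT, hL0⟩ := hS.cfcSqrt_spec
  rw [← hL] at hLL hLT hL0
  have hdet : L.det * L.det = S.det := by rw [← det_mul, hLL]
  have hLu : IsUnit L.det := isUnit_iff_ne_zero.2 hL0
  have hquad : ∀ v : Fin n → ℝ, (L *ᵥ v) ⬝ᵥ S⁻¹ *ᵥ (L *ᵥ v) = v ⬝ᵥ v := by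
    intro v
    rw [← hLL, Matrix.mul_inv_rev, mulVec_mulVec, mul_assoc, nonsing_inv_mul _ hLu, mul_one,
      dotProduct_comm, dotProduct_mulVec, ← mulVec_transpose, hLT, mulVec_mulVec,
      mul_nonsing_inv _ hLu, one_mulVec]
  have hlin : LinearMap.det (toEuclideanCLM (𝕜 := ℝ) L : Action n →ₗ[ℝ] Action n) = L.det := by
    rw [coe_toEuclideanCLM_eq_toEuclideanLin]
    exact LinearMap.det_toLpLin 2 L
  have hmap := Measure.map_linearMap_addHaar_eq_smul_addHaar (volume : Measure (Action n))
    (f := (toEuclideanCLM (𝕜 := ℝ) L : Action n →ₗ[ℝ] Action n)) (by rwa [hlin])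
  rw [hlin] at hmap
  have hgm := (measurable_gaussianDensity c (S := S)).ennreal_ofReal
  have hpt : ∀ u : Action n, (√((2 * Real.pi) ^ n))⁻¹ * Real.exp (-(1 / 2) * ‖u‖ ^ 2)
      = |L.det| * gaussianDensity c S (c + toEuclideanCLM (𝕜 := ℝ) L u) := by
    intro u
    rw [gaussianDensity, add_sub_cancel_left, ofLp_toEuclideanCLM, hquad, ← hdet,
      EuclideanSpace.real_norm_sq_eq, Real.sqrt_mul (by positivity), Real.sqrt_mul_self_eq_abs]
    have : (u.ofLp ⬝ᵥ u.ofLp) = ∑ i, u i ^ 2 := by simp [dotProduct, sq]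
    rw [this]
    have := abs_pos.2 hL0
    field_simp
  refine Measure.ext_of_lintegral _ fun f hf ↦ ?_
  have hA : Measurable fun u : Action n ↦ c + toEuclideanCLM (𝕜 := ℝ) L u := by fun_prop
  rw [multivariateGaussian, ← hL, lintegral_map hf hA, stdGaussian_eq_withDensity,
    lintegral_withDensity_eq_lintegral_mul _ (by fun_prop) (by fun_prop),
    lintegral_withDensity_eq_lintegral_mul _ hgm hf]
  simp only [Pi.mul_apply, hpt, ENNReal.ofReal_mul (abs_nonneg L.det), mul_assoc]
  have hF : Measurable fun u : Action n ↦ ENNReal.ofReal (gaussianDensity c S u) * f u :=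
    hgm.mul hf
  refine (lintegral_const_mul _ (hF.comp hA)).trans ?_
  have h1 := lintegral_map (μ := (volume : Measure (Action n)))
    (f := fun u ↦ ENNReal.ofReal (gaussianDensity c S (c + u)) * f (c + u))
    (g := (toEuclideanCLM (𝕜 := ℝ) L : Action n →ₗ[ℝ] Action n))
    (hF.comp (measurable_const_add c)) (toEuclideanCLM (𝕜 := ℝ) L).continuous.measurable
  rw [hmap, lintegral_smul_measure, lintegral_add_left_eq_self
    (fun u ↦ ENNReal.ofReal (gaussianDensity c S u) * f u) c] at h1
  refine (congrArg (ENNReal.ofReal |L.det| * ·) h1.symm).trans ?_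
  simp only [smul_eq_mul]
  rw [← mul_assoc, ← ENNReal.ofReal_mul (abs_nonneg _), abs_inv, mul_inv_cancel₀ (abs_ne_zero.2 hL0),
    ENNReal.ofReal_one, one_mul]

lemma integrable_quadratic_of_memLp {p : Measure (Action n)} [IsProbabilityMeasure p]
    (hp : MemLp id 2 p) (M : Matrix (Fin n) (Fin n) ℝ) (b : Fin n → ℝ) (a : ℝ) :
    Integrable (fun u : Action n ↦ u.ofLp ⬝ᵥ M *ᵥ u.ofLp + b ⬝ᵥ u.ofLp + a) p := by
  have h1 : ∀ i, MemLp (fun u : Action n ↦ u i) 2 p := fun i ↦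
    hp.of_le (Measurable.aestronglyMeasurable (by fun_prop))
      (.of_forall fun u ↦ PiLp.norm_apply_le u i)
  simp only [dotProduct, mulVec, Finset.mul_sum]
  refine ((integrable_finsetSum _ fun i _ ↦ integrable_finsetSum _ fun j _ ↦ ?_).add
    (integrable_finsetSum _ fun i _ ↦ ?_)).add (integrable_const a)
  · have := ((h1 i).integrable_mul (h1 j)).const_mul (M i j)
    refine this.congr (.of_forall fun u ↦ ?_)
    simp only [Pi.mul_apply]
    ring
  · exact ((h1 i).integrable (by norm_num)).const_mul (b i)

end Gaussian

end EntropyLQ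

namespace EntropyLQ

open scoped ENNReal

/-! ### Second moments and the completed square -/

section

variable {n : ℕ}

open scoped MatrixOrder in
-- `uᵀRu = ‖√R u‖²` and `√R` is invertible. Policies carry no moment condition, so second moments
-- must come from finite cost.
lemma memLp_of_integrable_quadratic {R : Matrix (Fin n) (Fin n) ℝ} (hR : R.PosDef)
    {p : Measure (Action n)} (h : Integrable (fun u : Action n ↦ u.ofLp ⬝ᵥ R *ᵥ u.ofLp) p) :
    MemLp id 2 p := by
  set L := CFC.sqrt R with hL
  obtain ⟨hLL, hLT, hL0⟩ := hR.cfcSqrt_spec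
  rw [← hL] at hLL hLT hL0
  have hLu : IsUnit L.det := isUnit_iff_ne_zero.2 hL0
  have hm : MemLp (fun u : Action n ↦ toEuclideanCLM (𝕜 := ℝ) L u) 2 p := by
    refine (memLp_two_iff_integrable_sq_norm
      (Measurable.aestronglyMeasurable (by fun_prop))).2 (h.congr (.of_forall fun u ↦ ?_))
    have h1 : ‖toEuclideanCLM (𝕜 := ℝ) L u‖ ^ 2 = (L *ᵥ u.ofLp) ⬝ᵥ (L *ᵥ u.ofLp) := by
      rw [EuclideanSpace.real_norm_sq_eq, ofLp_toEuclideanCLM]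
      simp [dotProduct, sq]
    simp only
    have h2 : u.ofLp ⬝ᵥ (Lᵀ * L) *ᵥ u.ofLp = (L *ᵥ u.ofLp) ⬝ᵥ (L *ᵥ u.ofLp) := by
      rw [← mulVec_mulVec, dotProduct_mulVec, vecMul_transpose]
    rw [h1, ← h2, hLT, hLL]
  have h2 := (toEuclideanCLM (𝕜 := ℝ) L⁻¹).comp_memLp' hm
  have h3 : (toEuclideanCLM (𝕜 := ℝ) L⁻¹) ∘ (fun u : Action n ↦ toEuclideanCLM (𝕜 := ℝ) L u)
      = id := by
    funext u
    ext i
    simp [mulVec_mulVec, nonsing_inv_mul _ hLu]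
  rwa [h3] at h2

lemma integral_affine_sq {ν : ℕ → Measure (Noise n)} [∀ t, IsProbabilityMeasure (ν t)]
    (hν : IsWhiteNoise ν) (t : ℕ) (a b : ℝ) (v : Fin n → ℝ) :
    Integrable (fun w : Noise n ↦ (a + w.1 * b + w.2 ⬝ᵥ v) ^ 2) (ν t) ∧
    ∫ w, (a + w.1 * b + w.2 ⬝ᵥ v) ^ 2 ∂(ν t) = a ^ 2 + b ^ 2 + v ⬝ᵥ v := by
  have hx2 : MemLp (fun w : Noise n ↦ w.1) 2 (ν t) := by
    refine (memLp_two_iff_integrable_sq (Measurable.aestronglyMeasurable (by fun_prop))).2 ?_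
    -- A nonintegrable function has Bochner integral `0`, so the prescribed value `1` already
    -- contains integrability.
    by_contra h
    have := hν.var_x t
    rw [integral_undef h] at this
    exact zero_ne_one this
  have hu2 : ∀ i, MemLp (fun w : Noise n ↦ w.2 i) 2 (ν t) := fun i ↦ by
    refine (memLp_two_iff_integrable_sq (Measurable.aestronglyMeasurable (by fun_prop))).2 ?_
    by_contra h
    have := hν.cov_u t i i
    simp only [← sq] at this
    rw [integral_undef h, one_apply_eq] at this
    exact zero_ne_one this
  have hx : Integrable (fun w : Noise n ↦ w.1) (ν t) := hx2.integrable (by norm_num)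
  have hu : ∀ i, Integrable (fun w : Noise n ↦ w.2 i) (ν t) := fun i ↦
    (hu2 i).integrable (by norm_num)
  have hxx : Integrable (fun w : Noise n ↦ w.1 ^ 2) (ν t) := hx2.integrable_sq
  have hxu : ∀ i, Integrable (fun w : Noise n ↦ w.1 * w.2 i) (ν t) := fun i ↦
    hx2.integrable_mul (hu2 i)
  have huu : ∀ i j, Integrable (fun w : Noise n ↦ w.2 i * w.2 j) (ν t) := fun i j ↦
    (hu2 i).integrable_mul (hu2 j)
  have hexp : (fun w : Noise n ↦ (a + w.1 * b + w.2 ⬝ᵥ v) ^ 2)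
      = fun w ↦ (a ^ 2 + (2 * a * b) * w.1 + b ^ 2 * w.1 ^ 2)
        + (∑ i, ((2 * a * v i) * w.2 i + (2 * b * v i) * (w.1 * w.2 i))
          + ∑ i, ∑ j, (v i * v j) * (w.2 i * w.2 j)) := by
    funext w
    have h1 : ∑ i, ((2 * a * v i) * w.2 i + (2 * b * v i) * (w.1 * w.2 i))
        = 2 * (a + w.1 * b) * (w.2 ⬝ᵥ v) := by
      simp only [dotProduct, Finset.mul_sum]
      exact Finset.sum_congr rfl fun i _ ↦ by ring
    have h2 : ∑ i, ∑ j, (v i * v j) * (w.2 i * w.2 j) = (w.2 ⬝ᵥ v) ^ 2 := by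
      simp only [dotProduct, sq, Finset.sum_mul_sum]
      exact Finset.sum_congr rfl fun i _ ↦ Finset.sum_congr rfl fun j _ ↦ by ring
    rw [h1, h2]
    ring
  have i1 : Integrable (fun w : Noise n ↦ a ^ 2 + (2 * a * b) * w.1) (ν t) :=
    (integrable_const _).add (hx.const_mul _)
  have i2 : Integrable (fun w : Noise n ↦ a ^ 2 + (2 * a * b) * w.1 + b ^ 2 * w.1 ^ 2) (ν t) :=
    i1.add (hxx.const_mul _)
  have i3 : ∀ i, Integrable (fun w : Noise n ↦
      (2 * a * v i) * w.2 i + (2 * b * v i) * (w.1 * w.2 i)) (ν t) := fun i ↦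
    ((hu i).const_mul _).add ((hxu i).const_mul _)
  have i3' := integrable_finsetSum Finset.univ fun i _ ↦ i3 i
  have i4 : ∀ i j, Integrable (fun w : Noise n ↦ (v i * v j) * (w.2 i * w.2 j)) (ν t) :=
    fun i j ↦ (huu i j).const_mul _
  have i5 : ∀ i, Integrable (fun w : Noise n ↦ ∑ j, (v i * v j) * (w.2 i * w.2 j)) (ν t) :=
    fun i ↦ integrable_finsetSum Finset.univ fun j _ ↦ i4 i j
  have i5' := integrable_finsetSum Finset.univ fun i _ ↦ i5 i
  have i6 : Integrable (fun w : Noise n ↦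
      ∑ i, ((2 * a * v i) * w.2 i + (2 * b * v i) * (w.1 * w.2 i))
        + ∑ i, ∑ j, (v i * v j) * (w.2 i * w.2 j)) (ν t) := i3'.add i5'
  rw [hexp]
  refine ⟨i2.add i6, ?_⟩
  rw [integral_add i2 i6, integral_add i3' i5', integral_add i1 (hxx.const_mul _),
    integral_add (integrable_const _) (hx.const_mul _), integral_finsetSum _ fun i _ ↦ i3 i,
    integral_finsetSum _ fun i _ ↦ i5 i]
  have e1 : ∀ i, ∫ w : Noise n, ((2 * a * v i) * w.2 i + (2 * b * v i) * (w.1 * w.2 i)) ∂(ν t)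
      = 0 := fun i ↦ by
    rw [integral_add ((hu i).const_mul _) ((hxu i).const_mul _), integral_const_mul,
      integral_const_mul, hν.mean_u, hν.cov_xu]
    simp
  have e2 : ∀ i, ∫ w : Noise n, (∑ j, (v i * v j) * (w.2 i * w.2 j)) ∂(ν t) = v i * v i :=
    fun i ↦ by
      rw [integral_finsetSum _ fun j _ ↦ i4 i j]
      simp only [integral_const_mul, hν.cov_u, one_apply]
      simp
  simp only [e1, e2, integral_const_mul, hν.mean_x, hν.var_x]
  simp [dotProduct]

end

namespace Model

variable {n : ℕ} (m : Model n)

/-- `𝔼[xₜ₊₁² | xₜ = y, uₜ = u]`. -/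
def nextSq (y : ℝ) (u : Action n) : ℝ :=
  (m.A ^ 2 + m.C ^ 2) * y ^ 2 + 2 * m.A * y * (m.B ⬝ᵥ u.ofLp)
    + u.ofLp ⬝ᵥ (vecMulVec m.B m.B + m.Dᵀ * m.D) *ᵥ u.ofLp

/-- The sum-of-squares form shows nonnegativity and matches the noise average of an affine square.
-/
lemma nextSq_eq (y : ℝ) (u : Action n) :
    m.nextSq y u = (m.A * y + m.B ⬝ᵥ u.ofLp) ^ 2 + (m.C * y) ^ 2
      + (m.D *ᵥ u.ofLp) ⬝ᵥ (m.D *ᵥ u.ofLp) := by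
  have h1 : u.ofLp ⬝ᵥ vecMulVec m.B m.B *ᵥ u.ofLp = (m.B ⬝ᵥ u.ofLp) ^ 2 := by
    rw [vecMulVec_mulVec, dotProduct_smul]
    simp [dotProduct_comm, sq]
  have h2 : u.ofLp ⬝ᵥ (m.Dᵀ * m.D) *ᵥ u.ofLp = (m.D *ᵥ u.ofLp) ⬝ᵥ (m.D *ᵥ u.ofLp) := by
    rw [← mulVec_mulVec, dotProduct_mulVec, vecMul_transpose]
  rw [nextSq, add_mulVec, dotProduct_add, h1, h2]
  ring

lemma nextSq_nonneg (y : ℝ) (u : Action n) : 0 ≤ m.nextSq y u := by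
  rw [nextSq_eq]
  have : 0 ≤ (m.D *ᵥ u.ofLp) ⬝ᵥ (m.D *ᵥ u.ofLp) :=
    Finset.sum_nonneg fun i _ ↦ mul_self_nonneg _
  positivity

lemma lintegral_next_sq {ν : ℕ → Measure (Noise n)} [∀ t, IsProbabilityMeasure (ν t)]
    (hν : IsWhiteNoise ν) (t : ℕ) {P : ℝ} (hP : 0 ≤ P) (y : ℝ) (u : Action n) :
    ∫⁻ w, ENNReal.ofReal (P * m.next (y, u, w) ^ 2) ∂(ν t) = ENNReal.ofReal (P * m.nextSq y u) := by
  have h := integral_affine_sq hν t (m.A * y + m.B ⬝ᵥ u.ofLp) (m.C * y) (m.D *ᵥ u.ofLp)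
  have he : ∀ w : Noise n, m.next (y, u, w)
      = m.A * y + m.B ⬝ᵥ u.ofLp + w.1 * (m.C * y) + w.2 ⬝ᵥ m.D *ᵥ u.ofLp := fun w ↦ by
    rw [next, add_dotProduct, dotProduct_mulVec]
    ring
  rw [nextSq_eq, ← h.2, ← integral_const_mul, ofReal_integral_eq_lintegral_ofReal (h.1.const_mul P)
    (.of_forall fun w ↦ mul_nonneg hP (sq_nonneg _))]
  simp_rw [he]

lemma hess_posDef (hR : m.R.PosDef) {P : ℝ} (hP : 0 ≤ m.γ * P) : (m.hess P).PosDef := by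
  refine hR.add_posSemidef (PosSemidef.smul (PosSemidef.add ?_ ?_) hP)
  · simpa using posSemidef_vecMulVec_self_star m.B
  · simpa using posSemidef_conjTranspose_mul_self m.D

lemma optCov_posDef (hR : m.R.PosDef) (hτ : 0 < m.τ) {P : ℝ} (hP : 0 ≤ m.γ * P) :
    (m.optCov P).PosDef :=
  (m.hess_posDef hR hP).inv.smul (by positivity)

/-- The mean of the optimal action in state `y`. -/
noncomputable def optMean (P y : ℝ) : Action n := WithLp.toLp 2 (-(y • m.optGain P))

/-- The two trace terms combine to `Tr(Σ* hess) = τ n / 2` and cancel the dimension term of the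
Gaussian entropy; only the log normalization remains. -/
lemma optConst_eq (hR : m.R.PosDef) (hγ1 : m.γ < 1) {P : ℝ} (hP : 0 ≤ m.γ * P) :
    (1 - m.γ) * m.optConst P
      = -(m.τ / 2) * Real.log ((2 * Real.pi) ^ n * (m.optCov P).det) := by
  have hM := m.hess_posDef hR hP
  have h1 : (m.optCov P * m.R).trace
      + m.γ * P * (m.optCov P * (vecMulVec m.B m.B + m.Dᵀ * m.D)).trace = m.τ / 2 * n := by
    rw [← smul_eq_mul (m.γ * P), ← trace_smul, ← Matrix.mul_smul, ← trace_add, ← Matrix.mul_add]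
    change (m.optCov P * m.hess P).trace = _
    rw [optCov, Matrix.smul_mul, nonsing_inv_mul _ (isUnit_iff_ne_zero.2 hM.det_pos.ne'),
      trace_smul, trace_one]
    simp
  have : 1 - m.γ ≠ 0 := by linarith
  rw [optConst, h1]
  field_simp
  ring

/-- The gain solves `hess K* = γ A P Bᵀ`, so its cross term with `v` is the one produced by the
dynamics. Used with `s = y` to complete the square and with `s = -1` to compare feedbacks. -/
lemma hess_quadratic_add_optGain (hR : m.R.PosDef) {P : ℝ} (hP : 0 ≤ m.γ * P) (v : Fin n → ℝ)
    (s : ℝ) :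
    (v + s • m.optGain P) ⬝ᵥ m.hess P *ᵥ (v + s • m.optGain P)
      = v ⬝ᵥ m.R *ᵥ v + m.γ * P * (v ⬝ᵥ (vecMulVec m.B m.B + m.Dᵀ * m.D) *ᵥ v)
        + 2 * s * ((m.γ * m.A * P) * (m.B ⬝ᵥ v))
        + s ^ 2 * ((m.γ * m.A * P) ^ 2 * (m.B ⬝ᵥ (m.hess P)⁻¹ *ᵥ m.B)) := by
  have hM := m.hess_posDef hR hP
  have hMu : IsUnit (m.hess P).det := isUnit_iff_ne_zero.2 hM.det_pos.ne'
  have hMT : (m.hess P)ᵀ = m.hess P := by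
    rw [← conjTranspose_eq_transpose_of_trivial]; exact hM.1
  have hMK : m.hess P *ᵥ m.optGain P = (m.γ * m.A * P) • m.B := by
    rw [optGain, mulVec_smul, mulVec_mulVec, mul_nonsing_inv _ hMu, one_mulVec]
  have hKMK : m.optGain P ⬝ᵥ m.hess P *ᵥ m.optGain P
      = (m.γ * m.A * P) ^ 2 * (m.B ⬝ᵥ (m.hess P)⁻¹ *ᵥ m.B) := by
    rw [hMK, optGain, smul_dotProduct, dotProduct_smul, dotProduct_comm]
    simp only [smul_eq_mul]
    ring
  have hKMv : m.optGain P ⬝ᵥ m.hess P *ᵥ v = (m.γ * m.A * P) * (m.B ⬝ᵥ v) := by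
    rw [dotProduct_mulVec, ← mulVec_transpose, hMT, hMK, smul_dotProduct, smul_eq_mul]
  have hvMK : v ⬝ᵥ m.hess P *ᵥ m.optGain P = (m.γ * m.A * P) * (m.B ⬝ᵥ v) := by
    rw [hMK, dotProduct_smul, smul_eq_mul, dotProduct_comm]
  have hvMv : v ⬝ᵥ m.hess P *ᵥ v = v ⬝ᵥ m.R *ᵥ v
      + m.γ * P * (v ⬝ᵥ (vecMulVec m.B m.B + m.Dᵀ * m.D) *ᵥ v) := by
    rw [hess, add_mulVec, dotProduct_add, smul_mulVec, dotProduct_smul, smul_eq_mul]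
  rw [mulVec_add, add_dotProduct, dotProduct_add, dotProduct_add, mulVec_smul,
    dotProduct_smul, smul_dotProduct, smul_dotProduct, dotProduct_smul, hKMK, hvMK, hKMv, hvMv]
  simp only [smul_eq_mul]
  ring

/-- Since `Σ*⁻¹ = (2 / τ) hess`, the term `-τ log g_y` is the completed square plus a constant. The
constants agree by `optConst_eq`, and the coefficients of `y²` agree exactly by the Riccati
equation. -/
lemma stage_add_nextSq (hR : m.R.PosDef) (hγ1 : m.γ < 1) (hτ : 0 < m.τ) {P : ℝ}
    (hP : 0 ≤ m.γ * P) (hARE : m.SolvesARE P) (y : ℝ) (u : Action n) :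
    m.Q * y ^ 2 + u.ofLp ⬝ᵥ m.R *ᵥ u.ofLp + m.γ * (P * m.nextSq y u)
      = P * y ^ 2 + (1 - m.γ) * m.optConst P
        - m.τ * Real.log (gaussianDensity (m.optMean P y) (m.optCov P) u) := by
  have hM := m.hess_posDef hR hP
  have hMu : IsUnit (m.hess P).det := isUnit_iff_ne_zero.2 hM.det_pos.ne'
  have hinv : (m.optCov P)⁻¹ = (2 / m.τ) • m.hess P := by
    refine inv_eq_left_inv ?_
    rw [optCov, Matrix.smul_mul, Matrix.mul_smul, mul_nonsing_inv _ hMu, smul_smul]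
    have : 2 / m.τ * (m.τ / 2) = 1 := by field_simp
    rw [this, one_smul]
  have hsub : (u - m.optMean P y).ofLp = u.ofLp + y • m.optGain P := by
    simp [optMean]
  rw [log_gaussianDensity _ (m.optCov_posDef hR hτ hP), m.optConst_eq hR hγ1 hP, hinv, smul_mulVec,
    dotProduct_smul, hsub, m.hess_quadratic_add_optGain hR hP, smul_eq_mul, nextSq]
  have hA : P = _ := hARE
  field_simp
  linear_combination (-2 * y ^ 2) * hA

end Model

end EntropyLQ

/-! ### The one-stage Bellman inequality -/

namespace EntropyLQ
namespace Model

open scoped ENNReal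

variable {n : ℕ} (m : Model n)

/-- The expected nonnegative part of the stage cost in state `y` under the action law `p`. -/
noncomputable def stageCost (p : Measure (Action n)) (y : ℝ) : ℝ≥0∞ :=
  ∫⁻ u, ENNReal.ofReal (m.Q * y ^ 2 + u.ofLp ⬝ᵥ m.R *ᵥ u.ofLp) ∂p
    + ENNReal.ofReal m.τ * (-entropy p).toENNReal

/-- The nonnegative part of the entropy bonus of the action law `p`. -/
noncomputable def stageGain (p : Measure (Action n)) : ℝ≥0∞ :=
  ENNReal.ofReal m.τ * (entropy p).toENNReal

/-- `𝔼[P xₜ₊₁² | xₜ = y]` under the action law `p`. -/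
noncomputable def nextCost (P : ℝ) (p : Measure (Action n)) (y : ℝ) : ℝ≥0∞ :=
  ∫⁻ u, ENNReal.ofReal (P * m.nextSq y u) ∂p

/-- The cost side of the Bellman equation. -/
noncomputable def bellmanCost (P : ℝ) (p : Measure (Action n)) (y : ℝ) : ℝ≥0∞ :=
  m.stageCost p y + ENNReal.ofReal m.γ * m.nextCost P p y
    + ENNReal.ofReal (-((1 - m.γ) * m.optConst P))

/-- The value side of the Bellman equation. -/
noncomputable def bellmanValue (P : ℝ) (p : Measure (Action n)) (y : ℝ) : ℝ≥0∞ :=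
  ENNReal.ofReal (P * y ^ 2) + ENNReal.ofReal ((1 - m.γ) * m.optConst P) + m.stageGain p

variable {m} {P : ℝ} {p : Measure (Action n)} [IsProbabilityMeasure p]

lemma stage_nonneg (hQ : 0 < m.Q) (hR : m.R.PosDef) (y : ℝ) (u : Action n) :
    0 ≤ m.Q * y ^ 2 + u.ofLp ⬝ᵥ m.R *ᵥ u.ofLp := by
  have := hR.posSemidef.dotProduct_mulVec_nonneg u.ofLp
  simp only [star_trivial] at this
  positivity

lemma integrable_log_gaussianDensity {c : Action n} {S : Matrix (Fin n) (Fin n) ℝ} (hS : S.PosDef)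
    (hp : MemLp id 2 p) : Integrable (fun u ↦ Real.log (gaussianDensity c S u)) p := by
  have hsub : MemLp (fun u : Action n ↦ u - c) 2 p := hp.sub (memLp_const c)
  have h2 : MemLp id 2 (p.map fun u ↦ u - c) :=
    (memLp_map_measure_iff (by fun_prop) (by fun_prop)).2 hsub
  have := Measure.isProbabilityMeasure_map (μ := p) (f := fun u : Action n ↦ u - c) (by fun_prop)
  have h3 := (integrable_quadratic_of_memLp h2 S⁻¹ 0 0).comp_measurable
    (f := fun u : Action n ↦ u - c) (by fun_prop)
  simp_rw [log_gaussianDensity _ hS]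
  refine (integrable_const _).sub (Integrable.const_mul ?_ _)
  refine h3.congr (.of_forall fun u ↦ ?_)
  simp

/-- The integral of `stage_add_nextSq` against `p`. The right side is `τ` times the relative entropy
of `p` with respect to the optimal Gaussian. -/
lemma bellmanCost_sub_bellmanValue (hQ : 0 < m.Q) (hR : m.R.PosDef) (hγ0 : 0 < m.γ)
    (hγ1 : m.γ < 1) (hτ : 0 < m.τ) (hP : 0 < P) (hARE : m.SolvesARE P)
    (hp : MemLp id 2 p) {h : ℝ} (hh : entropy p = h) (y : ℝ) :
    m.bellmanCost P p y ≠ ⊤ ∧ m.bellmanValue P p y ≠ ⊤ ∧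
    (m.bellmanCost P p y).toReal - (m.bellmanValue P p y).toReal
      = -m.τ * (h + ∫ u, Real.log (gaussianDensity (m.optMean P y) (m.optCov P) u) ∂p) := by
  have hγP : 0 ≤ m.γ * P := by positivity
  have hS := m.optCov_posDef hR hτ hγP
  have hL := integrable_log_gaussianDensity (c := m.optMean P y) hS hp
  have hI1 : Integrable (fun u : Action n ↦ m.Q * y ^ 2 + u.ofLp ⬝ᵥ m.R *ᵥ u.ofLp) p := by
    refine (integrable_quadratic_of_memLp hp m.R 0 (m.Q * y ^ 2)).congr (.of_forall fun u ↦ ?_)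
    simp [add_comm]
  have hI2 : Integrable (fun u : Action n ↦ P * m.nextSq y u) p := by
    refine ((integrable_quadratic_of_memLp hp (vecMulVec m.B m.B + m.Dᵀ * m.D)
      ((2 * m.A * y) • m.B) ((m.A ^ 2 + m.C ^ 2) * y ^ 2)).congr (.of_forall fun u ↦ ?_)).const_mul P
    simp only [nextSq, smul_dotProduct, smul_eq_mul]
    ring
  have hsum : ∫ u, (m.Q * y ^ 2 + u.ofLp ⬝ᵥ m.R *ᵥ u.ofLp) ∂p + m.γ * ∫ u, P * m.nextSq y u ∂p
      = P * y ^ 2 + (1 - m.γ) * m.optConst P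
        - m.τ * ∫ u, Real.log (gaussianDensity (m.optMean P y) (m.optCov P) u) ∂p := by
    rw [← integral_const_mul, ← integral_add hI1 (hI2.const_mul _)]
    simp_rw [m.stage_add_nextSq hR hγ1 hτ hγP hARE]
    rw [integral_sub (integrable_const _) (hL.const_mul _), integral_const_mul]
    simp
  have hn2 : ∀ u, 0 ≤ P * m.nextSq y u := fun u ↦ mul_nonneg hP.le (m.nextSq_nonneg y u)
  have hn1 := stage_nonneg hQ hR y
  have e1 := ofReal_integral_eq_lintegral_ofReal hI1 (.of_forall hn1)
  have e2 := ofReal_integral_eq_lintegral_ofReal hI2 (.of_forall hn2)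
  have hneg : (-entropy p).toENNReal = ENNReal.ofReal (-h) := by
    rw [hh, ← EReal.coe_neg, EReal.real_coe_toENNReal]
  have hpos : (entropy p).toENNReal = ENNReal.ofReal h := by
    rw [hh, EReal.real_coe_toENNReal]
  have i1 : 0 ≤ ∫ u, (m.Q * y ^ 2 + u.ofLp ⬝ᵥ m.R *ᵥ u.ofLp) ∂p := integral_nonneg hn1
  have i2 : 0 ≤ ∫ u, P * m.nextSq y u ∂p := integral_nonneg hn2
  rw [bellmanCost, bellmanValue, stageCost, nextCost, stageGain, hneg, hpos, ← e1, ← e2]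
  have hmax : ∀ r : ℝ, max r 0 - max (-r) 0 = r := fun r ↦ by
    rcases le_total 0 r with h | h <;> simp [h]
  refine ⟨by finiteness, by finiteness, ?_⟩
  rw [ENNReal.toReal_add (by finiteness) (by finiteness),
    ENNReal.toReal_add (by finiteness) (by finiteness),
    ENNReal.toReal_add (by finiteness) (by finiteness),
    ENNReal.toReal_add (by finiteness) (by finiteness),
    ENNReal.toReal_add (by finiteness) (by finiteness)]
  simp only [ENNReal.toReal_mul, ENNReal.toReal_ofReal', max_eq_left i1, max_eq_left i2,
    max_eq_left hτ.le, max_eq_left hγ0.le, max_eq_left (mul_nonneg hP.le (sq_nonneg y))]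
  have h1 := hmax h
  have h2 := hmax ((1 - m.γ) * m.optConst P)
  linear_combination hsum - m.τ * h1 - h2

/-- Finite stage cost and gain give finite entropy and, as `R` is positive definite, finite second
moments; Gibbs' inequality with its equality case then applies. -/
lemma bellmanValue_le (hQ : 0 < m.Q) (hR : m.R.PosDef) (hγ0 : 0 < m.γ)
    (hγ1 : m.γ < 1) (hτ : 0 < m.τ) (hP : 0 < P) (hARE : m.SolvesARE P) {y : ℝ}
    (hc : m.stageCost p y ≠ ⊤) (hg : m.stageGain p ≠ ⊤) :
    m.bellmanCost P p y ≠ ⊤ ∧ m.bellmanValue P p y ≤ m.bellmanCost P p y ∧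
    (m.bellmanCost P p y ≤ m.bellmanValue P p y →
      p = multivariateGaussian (m.optMean P y) (m.optCov P)) := by
  have hγP : 0 ≤ m.γ * P := by positivity
  have hS := m.optCov_posDef hR hτ hγP
  have hτ0 : ENNReal.ofReal m.τ ≠ 0 := by simpa using hτ
  rw [stageCost, ENNReal.add_ne_top] at hc
  have hbot : entropy p ≠ ⊥ := fun h ↦ hc.2 (by simp [h, ENNReal.mul_top hτ0])
  have htop : entropy p ≠ ⊤ := fun h ↦ hg (by simp [stageGain, h, ENNReal.mul_top hτ0])
  obtain ⟨hac, hH⟩ := integrable_of_entropy_ne hbot htop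
  have hq : Integrable (fun u : Action n ↦ m.Q * y ^ 2 + u.ofLp ⬝ᵥ m.R *ᵥ u.ofLp) p := by
    refine ⟨?_, ?_⟩
    · simp only [dotProduct, mulVec]
      exact Measurable.aestronglyMeasurable (by fun_prop)
    · rw [hasFiniteIntegral_iff_ofReal (.of_forall (stage_nonneg hQ hR y))]
      exact hc.1.lt_top
  have hmem : MemLp id 2 p := by
    refine memLp_of_integrable_quadratic hR ((hq.sub (integrable_const (m.Q * y ^ 2))).congr
      (.of_forall fun u ↦ ?_))
    simp
  obtain ⟨h1, h2, h3⟩ := bellmanCost_sub_bellmanValue hQ hR hγ0 hγ1 hτ hP hARE hmem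
    (entropy_eq_integral hac hH) y
  have hN : IsProbabilityMeasure (volume.withDensity fun u ↦
      ENNReal.ofReal (gaussianDensity (m.optMean P y) (m.optCov P) u)) := by
    rw [← multivariateGaussian_eq_withDensity _ hS]
    infer_instance
  obtain ⟨g1, g2⟩ := integral_negMulLog_rnDeriv_add_le hac
    (measurable_gaussianDensity (m.optMean P y)) (gaussianDensity_pos (m.optMean P y) hS)
    hH (integrable_log_gaussianDensity hS hmem)
  refine ⟨h1, (ENNReal.toReal_le_toReal h2 h1).1 ?_, fun hle ↦ ?_⟩
  · nlinarith
  · rw [multivariateGaussian_eq_withDensity _ hS]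
    refine g2 (le_antisymm g1 ?_)
    have := (ENNReal.toReal_le_toReal h1 h2).2 hle
    nlinarith

lemma entropy_multivariateGaussian {S : Matrix (Fin n) (Fin n) ℝ} (hS : S.PosDef) (c : Action n) :
    entropy (multivariateGaussian c S)
      = ((-∫ u, Real.log (gaussianDensity c S u) ∂(multivariateGaussian c S) : ℝ) : EReal) := by
  have hmem : MemLp id 2 (multivariateGaussian c S) := IsGaussian.memLp_two_id
  have hlog := integrable_log_gaussianDensity (c := c) hS hmem
  rw [multivariateGaussian_eq_withDensity _ hS] at hlog ⊢
  obtain ⟨h1, h2⟩ := negMulLog_rnDeriv_withDensity (measurable_gaussianDensity c)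
    (gaussianDensity_pos c hS) hlog
  rw [entropy_eq_integral (withDensity_absolutelyContinuous _ _) h1, h2]

/-- Translation invariance makes the entropy bonus of the optimal policy independent of the state.
-/
lemma entropy_multivariateGaussian_eq_zero_mean {S : Matrix (Fin n) (Fin n) ℝ} (hS : S.PosDef)
    (c : Action n) :
    entropy (multivariateGaussian c S) = entropy (multivariateGaussian (0 : Action n) S) := by
  have hmap : multivariateGaussian c S
      = (multivariateGaussian (0 : Action n) S).map (fun u ↦ c + u) := by
    rw [multivariateGaussian, multivariateGaussian, Measure.map_map (by fun_prop) (by fun_prop)]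
    simp [Function.comp_def]
  rw [entropy_multivariateGaussian hS, entropy_multivariateGaussian hS]
  conv_lhs => rw [hmap]
  rw [integral_map (by fun_prop) (measurable_gaussianDensity c).log.aestronglyMeasurable]
  simp [gaussianDensity]

lemma bellman_multivariateGaussian (hQ : 0 < m.Q) (hR : m.R.PosDef) (hγ0 : 0 < m.γ)
    (hγ1 : m.γ < 1) (hτ : 0 < m.τ) (hP : 0 < P) (hARE : m.SolvesARE P) (y : ℝ) :
    m.bellmanCost P (multivariateGaussian (m.optMean P y) (m.optCov P)) y
      = m.bellmanValue P (multivariateGaussian (m.optMean P y) (m.optCov P)) y := by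
  have hS := m.optCov_posDef hR hτ (P := P) (by positivity)
  obtain ⟨h1, h2, h3⟩ := bellmanCost_sub_bellmanValue hQ hR hγ0 hγ1 hτ hP hARE
    (p := multivariateGaussian (m.optMean P y) (m.optCov P)) IsGaussian.memLp_two_id
    (entropy_multivariateGaussian hS _) y
  refine (ENNReal.toReal_eq_toReal_iff' h1 h2).1 ?_
  linarith

end Model
end EntropyLQ

/-! ### Summing Bellman gaps along the trajectory -/

namespace EntropyLQ
namespace Model

open scoped ENNReal

variable {n : ℕ} (m : Model n)

lemma measurable_stageCost (π : Policy n) : Measurable fun y ↦ m.stageCost (π.1 y) y := by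
  have hf : Measurable fun q : ℝ × Action n ↦
      ENNReal.ofReal (m.Q * q.1 ^ 2 + q.2.ofLp ⬝ᵥ m.R *ᵥ q.2.ofLp) := by
    simp only [dotProduct, mulVec]
    fun_prop
  exact (Measurable.lintegral_kernel_prod_right' hf).add
    ((measurable_entropy π).neg.ereal_toENNReal.const_mul _)

lemma measurable_stageGain (π : Policy n) : Measurable fun y ↦ m.stageGain (π.1 y) :=
  (measurable_entropy π).ereal_toENNReal.const_mul _

lemma measurable_nextCost (P : ℝ) (π : Policy n) : Measurable fun y ↦ m.nextCost P (π.1 y) y := by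
  have hf : Measurable fun q : ℝ × Action n ↦ ENNReal.ofReal (P * m.nextSq q.1 q.2) := by
    simp only [nextSq, dotProduct, mulVec]
    fun_prop
  exact Measurable.lintegral_kernel_prod_right' hf

lemma measurable_bellmanCost (P : ℝ) (π : Policy n) :
    Measurable fun y ↦ m.bellmanCost P (π.1 y) y :=
  ((m.measurable_stageCost π).add ((m.measurable_nextCost P π).const_mul _)).add_const _

lemma measurable_bellmanValue (P : ℝ) (π : Policy n) :
    Measurable fun y ↦ m.bellmanValue P (π.1 y) y :=
  Measurable.add (by fun_prop) (m.measurable_stageGain π)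

variable (ν : ℕ → Measure (Noise n)) [∀ t, IsProbabilityMeasure (ν t)] (π : Policy n) (x : ℝ)

/-- `𝔼[P xₜ²]`. -/
noncomputable def expectedSq (P : ℝ) (t : ℕ) : ℝ≥0∞ :=
  ∫⁻ y, ENNReal.ofReal (P * y ^ 2) ∂(m.stateLaw ν π x t)

lemma expectedSq_zero (P : ℝ) : m.expectedSq ν π x P 0 = ENNReal.ofReal (P * x ^ 2) := by
  rw [expectedSq, stateLaw_zero, lintegral_dirac' _ (by fun_prop)]

variable {ν} in
lemma expectedSq_succ (hν : IsWhiteNoise ν) {P : ℝ} (hP : 0 ≤ P) (t : ℕ) :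
    m.expectedSq ν π x P (t + 1)
      = ∫⁻ y, m.nextCost P (π.1 y) y ∂(m.stateLaw ν π x t) := by
  rw [expectedSq, lintegral_stateLaw_succ _ _ _ _ _ (by fun_prop)]
  simp_rw [lintegral_next_sq m hν t hP]
  rfl

lemma costPart_eq (hγ0 : 0 < m.γ) : m.costPart ν π x
    = ∑' t, ENNReal.ofReal m.γ ^ t * ∫⁻ y, m.stageCost (π.1 y) y ∂(m.stateLaw ν π x t) := by
  have hf : Measurable fun o : Outcome n ↦
      ENNReal.ofReal (m.Q * o.1 ^ 2 + o.2.1.ofLp ⬝ᵥ m.R *ᵥ o.2.1.ofLp) := by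
    simp only [dotProduct, mulVec]
    fun_prop
  have he : Measurable fun y ↦ (-entropy (π.1 y)).toENNReal :=
    (measurable_entropy π).neg.ereal_toENNReal
  have hF : Measurable fun o : Outcome n ↦
      ENNReal.ofReal (m.Q * o.1 ^ 2 + o.2.1.ofLp ⬝ᵥ m.R *ᵥ o.2.1.ofLp)
        + ENNReal.ofReal m.τ * (-entropy (π.1 o.1)).toENNReal :=
    hf.add ((he.comp measurable_fst).const_mul _)
  have hFt : ∀ t : ℕ, Measurable fun ω : ℕ → Outcome n ↦
      ENNReal.ofReal (m.Q * (ω t).1 ^ 2 + (ω t).2.1.ofLp ⬝ᵥ m.R *ᵥ (ω t).2.1.ofLp)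
        + ENNReal.ofReal m.τ * (-entropy (π.1 (ω t).1)).toENNReal :=
    fun t ↦ hF.comp (measurable_pi_apply t)
  rw [costPart, lintegral_tsum fun t ↦ ((hFt t).const_mul _).aemeasurable]
  refine tsum_congr fun t ↦ ?_
  rw [lintegral_const_mul _ (hFt t), ENNReal.ofReal_pow hγ0.le,
    m.lintegral_pathLaw_eval ν π x t hF]
  congr 1
  refine lintegral_congr fun y ↦ ?_
  simp [stageCost, lintegral_add_right]

lemma gainPart_eq (hγ0 : 0 < m.γ) : m.gainPart ν π x
    = ∑' t, ENNReal.ofReal m.γ ^ t * ∫⁻ y, m.stageGain (π.1 y) ∂(m.stateLaw ν π x t) := by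
  have hm := m.measurable_stageGain π
  have hFt : ∀ t : ℕ, Measurable fun ω : ℕ → Outcome n ↦
      ENNReal.ofReal m.τ * (entropy (π.1 (ω t).1)).toENNReal :=
    fun t ↦ hm.comp (measurable_fst.comp (measurable_pi_apply t))
  rw [gainPart, lintegral_tsum fun t ↦ ((hFt t).const_mul _).aemeasurable]
  refine tsum_congr fun t ↦ ?_
  rw [lintegral_const_mul _ (hFt t), ENNReal.ofReal_pow hγ0.le,
    m.lintegral_stateLaw ν π x t hm]
  rfl

lemma value_eq_coe (hc : m.costPart ν π x ≠ ⊤) (hg : m.gainPart ν π x ≠ ⊤) :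
    m.value ν π x = (((m.costPart ν π x).toReal - (m.gainPart ν π x).toReal : ℝ) : EReal) := by
  rw [value, if_neg hg, EReal.coe_sub, EReal.coe_ennreal_toReal hc, EReal.coe_ennreal_toReal hg]

lemma value_eq_top_of_not (h : ¬ (m.costPart ν π x ≠ ⊤ ∧ m.gainPart ν π x ≠ ⊤)) :
    m.value ν π x = ⊤ := by
  rw [value]
  split_ifs with hg
  · rfl
  · have hc : m.costPart ν π x = ⊤ := by
      by_contra hc
      exact h ⟨hc, hg⟩
    rw [hc, ← EReal.coe_ennreal_toReal hg]
    exact EReal.top_sub_coe _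

/-- The loss of the action law `π(·|y)` against the Bellman equation in state `y`. -/
noncomputable def bellmanGap (P y : ℝ) : ℝ≥0∞ :=
  m.bellmanCost P (π.1 y) y - m.bellmanValue P (π.1 y) y

lemma measurable_bellmanGap (P : ℝ) : Measurable (m.bellmanGap π P) :=
  (m.measurable_bellmanCost P π).sub (m.measurable_bellmanValue P π)

variable {m ν} in
lemma lintegral_bellmanCost (hν : IsWhiteNoise ν) {P : ℝ} (hP : 0 ≤ P) (t : ℕ) :
    ∫⁻ y, m.bellmanCost P (π.1 y) y ∂(m.stateLaw ν π x t)
      = ∫⁻ y, m.stageCost (π.1 y) y ∂(m.stateLaw ν π x t)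
        + ENNReal.ofReal m.γ * m.expectedSq ν π x P (t + 1)
        + ENNReal.ofReal (-((1 - m.γ) * m.optConst P)) := by
  simp only [bellmanCost]
  rw [lintegral_add_right _ measurable_const,
    lintegral_add_left (m.measurable_stageCost π), lintegral_const_mul _ (m.measurable_nextCost P π),
    expectedSq_succ m π x hν hP]
  simp

lemma lintegral_bellmanValue (P : ℝ) (t : ℕ) :
    ∫⁻ y, m.bellmanValue P (π.1 y) y ∂(m.stateLaw ν π x t)
      = m.expectedSq ν π x P t + ENNReal.ofReal ((1 - m.γ) * m.optConst P)
        + ∫⁻ y, m.stageGain (π.1 y) ∂(m.stateLaw ν π x t) := by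
  simp only [bellmanValue]
  rw [lintegral_add_right _ (m.measurable_stageGain π), lintegral_add_right _ measurable_const]
  simp [expectedSq]

/-- The stage cost contains `Q y²`. This replaces a transversality condition: finite cost alone
makes `γᵗ 𝔼[P xₜ²]` summable. -/
lemma expectedSq_le (hQ : 0 < m.Q) (hR : m.R.PosDef) {P : ℝ} (hP : 0 < P) (t : ℕ) :
    m.expectedSq ν π x P t
      ≤ ENNReal.ofReal (P / m.Q) * ∫⁻ y, m.stageCost (π.1 y) y ∂(m.stateLaw ν π x t) := by
  rw [expectedSq, ← lintegral_const_mul _ (m.measurable_stageCost π)]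
  refine lintegral_mono fun y ↦ ?_
  have h1 : P * y ^ 2 = P / m.Q * (m.Q * y ^ 2) := by field_simp
  simp only
  rw [h1, ENNReal.ofReal_mul (by positivity)]
  gcongr
  have h2 : ENNReal.ofReal (m.Q * y ^ 2)
      ≤ ∫⁻ u, ENNReal.ofReal (m.Q * y ^ 2 + u.ofLp ⬝ᵥ m.R *ᵥ u.ofLp) ∂(π.1 y) := by
    calc ENNReal.ofReal (m.Q * y ^ 2) = ∫⁻ _, ENNReal.ofReal (m.Q * y ^ 2) ∂(π.1 y) := by simp
    _ ≤ _ := lintegral_mono fun u ↦ ENNReal.ofReal_le_ofReal (by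
        have := hR.posSemidef.dotProduct_mulVec_nonneg u.ofLp
        simp only [star_trivial] at this
        linarith)
  exact h2.trans le_self_add

variable {m ν π x} in
/-- The cost of a policy exceeds the candidate value function by its discounted Bellman gaps. -/
lemma hasSum_bellmanGap (hν : IsWhiteNoise ν) (hQ : 0 < m.Q) (hR : m.R.PosDef) (hγ0 : 0 < m.γ)
    (hγ1 : m.γ < 1) (hτ : 0 < m.τ) {P : ℝ} (hP : 0 < P) (hARE : m.SolvesARE P)
    (hc : m.costPart ν π x ≠ ⊤) (hg : m.gainPart ν π x ≠ ⊤) :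
    (∀ t, ∫⁻ y, m.bellmanGap π P y ∂(m.stateLaw ν π x t) ≠ ⊤) ∧
    HasSum (fun t ↦ m.γ ^ t * (∫⁻ y, m.bellmanGap π P y ∂(m.stateLaw ν π x t)).toReal)
      ((m.costPart ν π x).toReal - (m.gainPart ν π x).toReal - (P * x ^ 2 + m.optConst P)) := by
  rw [costPart_eq m ν π x hγ0] at hc ⊢
  rw [gainPart_eq m ν π x hγ0] at hg ⊢
  set c : ℕ → ℝ≥0∞ := fun t ↦ ∫⁻ y, m.stageCost (π.1 y) y ∂(m.stateLaw ν π x t) with hcdef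
  set g : ℕ → ℝ≥0∞ := fun t ↦ ∫⁻ y, m.stageGain (π.1 y) ∂(m.stateLaw ν π x t) with hgdef
  set e : ℕ → ℝ≥0∞ := m.expectedSq ν π x P with hedef
  set d : ℕ → ℝ≥0∞ := fun t ↦ ∫⁻ y, m.bellmanGap π P y ∂(m.stateLaw ν π x t) with hddef
  have hγt : ∀ t : ℕ, ENNReal.ofReal m.γ ^ t ≠ 0 := fun t ↦
    pow_ne_zero _ (by simpa using hγ0)
  have hct : ∀ t, c t ≠ ⊤ := fun t h ↦
    ENNReal.ne_top_of_tsum_ne_top hc t (by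
      change ENNReal.ofReal m.γ ^ t * c t = ⊤
      rw [h, ENNReal.mul_top (hγt t)])
  have hgt : ∀ t, g t ≠ ⊤ := fun t h ↦
    ENNReal.ne_top_of_tsum_ne_top hg t (by
      change ENNReal.ofReal m.γ ^ t * g t = ⊤
      rw [h, ENNReal.mul_top (hγt t)])
  have hele : ∀ t, e t ≤ ENNReal.ofReal (P / m.Q) * c t := m.expectedSq_le ν π x hQ hR hP
  have het : ∀ t, e t ≠ ⊤ := fun t ↦
    ne_top_of_le_ne_top (ENNReal.mul_ne_top ENNReal.ofReal_ne_top (hct t)) (hele t)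
  set q := (1 - m.γ) * m.optConst P with hq
  have hid : ∀ t, d t + (e t + ENNReal.ofReal q + g t)
      = c t + ENNReal.ofReal m.γ * e (t + 1) + ENNReal.ofReal (-q) := fun t ↦ by
    rw [← lintegral_bellmanCost π x hν hP.le t, ← lintegral_bellmanValue m ν π x P t,
      ← lintegral_add_left (m.measurable_bellmanGap π P)]
    refine lintegral_congr_ae ?_
    filter_upwards [ae_lt_top (m.measurable_stageCost π) (hct t),
      ae_lt_top (m.measurable_stageGain π) (hgt t)] with y h1 h2
    -- The truncated subtraction in the gap is a true one, by the Bellman inequality, which holds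
    -- almost everywhere because cost and gain are finite there.
    exact tsub_add_cancel_of_le
      (bellmanValue_le hQ hR hγ0 hγ1 hτ hP hARE h1.ne h2.ne).2.1
  have hdt : ∀ t, d t ≠ ⊤ := fun t ↦ by
    have : c t + ENNReal.ofReal m.γ * e (t + 1) + ENNReal.ofReal (-q) ≠ ⊤ := by
      have := hct t
      have := het (t + 1)
      finiteness
    rw [← hid t] at this
    exact (ENNReal.add_ne_top.1 this).1
  refine ⟨hdt, ?_⟩
  have hmax : max q 0 - max (-q) 0 = q := by
    rcases le_total 0 q with h | h <;> simp [h]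
  have hidr : ∀ t, (d t).toReal
      = (c t).toReal + m.γ * (e (t + 1)).toReal - (e t).toReal - (g t).toReal - q := fun t ↦ by
    have h := congrArg ENNReal.toReal (hid t)
    have := hct t
    have := het (t + 1)
    have := het t
    have := hgt t
    have := hdt t
    rw [ENNReal.toReal_add (by finiteness) (by finiteness),
      ENNReal.toReal_add (by finiteness) (by finiteness),
      ENNReal.toReal_add (by finiteness) (by finiteness),
      ENNReal.toReal_add (by finiteness) (by finiteness),
      ENNReal.toReal_add (by finiteness) (by finiteness), ENNReal.toReal_mul,
      ENNReal.toReal_ofReal', ENNReal.toReal_ofReal', ENNReal.toReal_ofReal',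
      max_eq_left hγ0.le] at h
    linarith
  have hsum : ∀ f : ℕ → ℝ≥0∞, ∑' t, ENNReal.ofReal m.γ ^ t * f t ≠ ⊤ →
      HasSum (fun t ↦ m.γ ^ t * (f t).toReal) (∑' t, ENNReal.ofReal m.γ ^ t * f t).toReal := by
    intro f hf
    have h := ENNReal.hasSum_toReal hf
    rw [← ENNReal.tsum_toReal_eq fun t ↦ ENNReal.ne_top_of_tsum_ne_top hf t] at h
    simpa only [ENNReal.toReal_mul, ENNReal.toReal_pow, ENNReal.toReal_ofReal hγ0.le] using h
  have hsc := hsum c hc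
  have hsg := hsum g hg
  have hse : Summable fun t ↦ m.γ ^ t * (e t).toReal := by
    refine Summable.of_nonneg_of_le (fun t ↦ by positivity) (fun t ↦ ?_)
      (hsc.summable.mul_left (P / m.Q))
    have := ENNReal.toReal_mono (ENNReal.mul_ne_top ENNReal.ofReal_ne_top (hct t)) (hele t)
    rw [ENNReal.toReal_mul, ENNReal.toReal_ofReal (by positivity)] at this
    calc m.γ ^ t * (e t).toReal ≤ m.γ ^ t * (P / m.Q * (c t).toReal) := by gcongr
    _ = _ := by ring
  -- The shifted series sums to the full one minus its term at `0`; subtracting the full series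
  -- leaves `-P x²`.
  have hse1 := (hasSum_nat_add_iff' 1).2 hse.hasSum
  have hgeo := (hasSum_geometric_of_lt_one hγ0.le hγ1).mul_right q
  have htot := (((hsc.add hse1).sub hse.hasSum).sub hsg).sub hgeo
  have he0 : (e 0).toReal = P * x ^ 2 := by
    rw [hedef, expectedSq_zero, ENNReal.toReal_ofReal (by positivity)]
  have hqq : (1 - m.γ)⁻¹ * q = m.optConst P := by
    have : 1 - m.γ ≠ 0 := by linarith
    rw [hq]; field_simp
  rw [hqq] at htot
  have hfun : (fun t ↦ m.γ ^ t * (d t).toReal) = fun t ↦ m.γ ^ t * (c t).toReal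
      + m.γ ^ (t + 1) * (e (t + 1)).toReal - m.γ ^ t * (e t).toReal - m.γ ^ t * (g t).toReal
      - m.γ ^ t * q := by
    funext t
    rw [hidr t, pow_succ]
    ring
  have hcongr : ∀ {f : ℕ → ℝ} {a b : ℝ}, HasSum f a → a = b → HasSum f b := fun h h' ↦ h' ▸ h
  change HasSum (fun t ↦ m.γ ^ t * (d t).toReal) _
  rw [hfun]
  refine hcongr htot ?_
  rw [Finset.range_one, Finset.sum_singleton, pow_zero, one_mul, he0]
  ring

end Model
end EntropyLQ

/-! ### Riccati equation, optimal policy and uniqueness -/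

namespace EntropyLQ
namespace Model

open scoped ENNReal

variable {n : ℕ} (m : Model n)

lemma measurable_optMean (P : ℝ) : Measurable (m.optMean P) := by
  unfold optMean
  fun_prop

/-- The Gaussian policy `𝒩(-K* y, Σ*)`. -/
noncomputable def optPolicy (P : ℝ) : Policy n :=
  ⟨(Kernel.id ×ₖ Kernel.const ℝ (multivariateGaussian (0 : Action n) (m.optCov P))).map
    fun q : ℝ × Action n ↦ m.optMean P q.1 + q.2,
    Kernel.IsMarkovKernel.map _ (((m.measurable_optMean P).comp measurable_fst).add measurable_snd)⟩

lemma optPolicy_apply (P y : ℝ) :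
    (m.optPolicy P).1 y = multivariateGaussian (m.optMean P y) (m.optCov P) := by
  have hm : Measurable fun q : ℝ × Action n ↦ m.optMean P q.1 + q.2 :=
    ((m.measurable_optMean P).comp measurable_fst).add measurable_snd
  rw [optPolicy, Kernel.map_apply _ hm, Kernel.prod_apply, Kernel.id_apply, Kernel.const_apply,
    Measure.dirac_prod, Measure.map_map hm (by fun_prop), multivariateGaussian,
    multivariateGaussian, Measure.map_map (hm.comp (by fun_prop)) (by fun_prop)]
  simp [Function.comp_def]

/-- The slack is `(K - K*)ᵀ hess (K - K*) ≥ 0`: the Riccati map is the minimum over `K` of the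
affine maps of linear feedbacks. -/
lemma riccati_le_linear_feedback (hR : m.R.PosDef) {P : ℝ} (hP : 0 ≤ m.γ * P) (K : Fin n → ℝ) :
    m.Q + m.γ * P * (m.A ^ 2 + m.C ^ 2)
        - (m.γ * m.A * P) ^ 2 * (m.B ⬝ᵥ (m.hess P)⁻¹ *ᵥ m.B)
      ≤ m.Q + K ⬝ᵥ m.R *ᵥ K + m.γ * P * m.secondMomentFactor K := by
  have h := (m.hess_posDef hR hP).posSemidef.dotProduct_mulVec_nonneg
    (K + (-1 : ℝ) • m.optGain P)
  simp only [star_trivial] at h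
  rw [m.hess_quadratic_add_optGain hR hP] at h
  rw [secondMomentFactor]
  linarith

lemma exists_solvesARE (hQ : 0 < m.Q) (hR : m.R.PosDef) (hγ0 : 0 < m.γ)
    (hstab : ∃ K : Fin n → ℝ, m.γ * m.secondMomentFactor K < 1) :
    ∃ P : ℝ, 0 < P ∧ m.SolvesARE P := by
  obtain ⟨K, hK⟩ := hstab
  have hKR := hR.posSemidef.dotProduct_mulVec_nonneg K
  simp only [star_trivial] at hKR
  set f : ℝ → ℝ := fun P ↦ m.Q + m.γ * P * (m.A ^ 2 + m.C ^ 2)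
    - (m.γ * m.A * P) ^ 2 * (m.B ⬝ᵥ (m.hess P)⁻¹ *ᵥ m.B) - P with hf
  -- The fixed point of the affine map of the feedback `K`. The Riccati map lies below that map, so
  -- `f P₁ ≤ 0`, while `f 0 = Q > 0`.
  set P₁ := (m.Q + K ⬝ᵥ m.R *ᵥ K) / (1 - m.γ * m.secondMomentFactor K) with hP₁
  have hK' : 0 < 1 - m.γ * m.secondMomentFactor K := by linarith
  have hP₁0 : 0 ≤ P₁ := by positivity
  have hcont : ContinuousOn f (Set.Icc 0 P₁) := by
    have hh : Continuous m.hess := by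
      unfold hess
      fun_prop
    have hi : ContinuousOn (fun P ↦ m.B ⬝ᵥ (m.hess P)⁻¹ *ᵥ m.B) (Set.Icc 0 P₁) := by
      -- Written with the adjugate, the inverse is visibly continuous wherever the determinant is
      -- nonzero.
      have he : ∀ P, m.B ⬝ᵥ (m.hess P)⁻¹ *ᵥ m.B
          = (m.hess P).det⁻¹ * (m.B ⬝ᵥ (m.hess P).adjugate *ᵥ m.B) := fun P ↦ by
        rw [inv_def, Ring.inverse_eq_inv', smul_mulVec, dotProduct_smul, smul_eq_mul]
      simp_rw [he]
      refine ContinuousOn.mul (ContinuousOn.inv₀ hh.matrix_det.continuousOn fun P hP ↦ ?_) ?_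
      · exact (m.hess_posDef hR (mul_nonneg hγ0.le hP.1)).det_pos.ne'
      · exact (Continuous.dotProduct continuous_const
          (hh.matrix_adjugate.matrix_mulVec continuous_const)).continuousOn
    exact ((by fun_prop : Continuous fun P : ℝ ↦ m.Q + m.γ * P * (m.A ^ 2 + m.C ^ 2)).continuousOn.sub
      ((by fun_prop : Continuous fun P : ℝ ↦ (m.γ * m.A * P) ^ 2).continuousOn.mul hi)).sub
      continuousOn_id
  have hf0 : f 0 = m.Q := by simp [hf]
  have hf1 : f P₁ ≤ 0 := by
    have h1 := m.riccati_le_linear_feedback hR (mul_nonneg hγ0.le hP₁0) K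
    have h2 : P₁ * (1 - m.γ * m.secondMomentFactor K) = m.Q + K ⬝ᵥ m.R *ᵥ K :=
      div_mul_cancel₀ _ hK'.ne'
    simp only [hf]
    linarith
  obtain ⟨P, hP, hfP⟩ := intermediate_value_Icc' hP₁0 hcont ⟨hf1, by rw [hf0]; exact hQ.le⟩
  refine ⟨P, lt_of_le_of_ne hP.1 ?_, ?_⟩
  · rintro rfl
    rw [hf0] at hfP
    exact hQ.ne' hfP
  · rw [SolvesARE]
    simp only [hf] at hfP
    linarith

variable {m} {ν : ℕ → Measure (Noise n)} [∀ t, IsProbabilityMeasure (ν t)]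

lemma bellmanGap_optPolicy (hQ : 0 < m.Q) (hR : m.R.PosDef) (hγ0 : 0 < m.γ)
    (hγ1 : m.γ < 1) (hτ : 0 < m.τ) {P : ℝ} (hP : 0 < P) (hARE : m.SolvesARE P) (y : ℝ) :
    m.bellmanGap (m.optPolicy P) P y = 0 := by
  rw [bellmanGap, optPolicy_apply,
    bellman_multivariateGaussian hQ hR hγ0 hγ1 hτ hP hARE, tsub_self]

/-- The telescoped identity presupposes finiteness, so this is proved separately: the Bellman
equality bounds the partial sums of the cost by `P x²` plus a geometric series. -/
lemma finite_optPolicy (hν : IsWhiteNoise ν) (hQ : 0 < m.Q) (hR : m.R.PosDef) (hγ0 : 0 < m.γ)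
    (hγ1 : m.γ < 1) (hτ : 0 < m.τ) {P : ℝ} (hP : 0 < P) (hARE : m.SolvesARE P) (x : ℝ) :
    m.costPart ν (m.optPolicy P) x ≠ ⊤ ∧ m.gainPart ν (m.optPolicy P) x ≠ ⊤ := by
  have hS := m.optCov_posDef hR hτ (P := P) (by positivity)
  set H : ℝ≥0∞ := m.stageGain (multivariateGaussian (0 : Action n) (m.optCov P)) with hH
  have hHt : H ≠ ⊤ := by
    rw [hH, stageGain, entropy_multivariateGaussian hS, EReal.real_coe_toENNReal]
    finiteness
  have hgain : ∀ y, m.stageGain ((m.optPolicy P).1 y) = H := fun y ↦ by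
    rw [optPolicy_apply, hH, stageGain, stageGain, entropy_multivariateGaussian_eq_zero_mean hS]
  have hγlt : ENNReal.ofReal m.γ < 1 := by
    rw [← ENNReal.ofReal_one]
    exact (ENNReal.ofReal_lt_ofReal_iff one_pos).2 hγ1
  have hgeo : ∑' t : ℕ, ENNReal.ofReal m.γ ^ t ≠ ⊤ := by
    rw [ENNReal.tsum_geometric]
    exact ENNReal.inv_ne_top.2 (tsub_pos_of_lt hγlt).ne'
  refine ⟨?_, ?_⟩
  · rw [costPart_eq m ν _ x hγ0]
    set c : ℕ → ℝ≥0∞ := fun t ↦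
      ∫⁻ y, m.stageCost ((m.optPolicy P).1 y) y ∂(m.stateLaw ν (m.optPolicy P) x t) with hc
    set e : ℕ → ℝ≥0∞ := m.expectedSq ν (m.optPolicy P) x P with he
    set b := ENNReal.ofReal ((1 - m.γ) * m.optConst P) + H with hb
    have hstep : ∀ t, c t + ENNReal.ofReal m.γ * e (t + 1) ≤ e t + b := fun t ↦ by
      have h := lintegral_congr (μ := m.stateLaw ν (m.optPolicy P) x t) fun y ↦
        bellman_multivariateGaussian hQ hR hγ0 hγ1 hτ hP hARE y
      simp_rw [← optPolicy_apply] at h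
      rw [lintegral_bellmanCost _ x hν hP.le t, lintegral_bellmanValue m ν _ x P t] at h
      simp only [hgain, lintegral_const, measure_univ, mul_one, add_assoc] at h
      rw [hb, ← h, ← add_assoc]
      exact le_self_add
    -- The term `γᵀ e_T` (exponent `T`) is kept on the left so that the induction closes; it is
    -- dropped afterwards.
    have hind : ∀ T, ∑ t ∈ Finset.range T, ENNReal.ofReal m.γ ^ t * c t
        + ENNReal.ofReal m.γ ^ T * e T
        ≤ e 0 + ∑ t ∈ Finset.range T, ENNReal.ofReal m.γ ^ t * b := fun T ↦ by
      induction T with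
      | zero => simp
      | succ T ih =>
        rw [Finset.sum_range_succ, Finset.sum_range_succ]
        calc _ = ∑ t ∈ Finset.range T, ENNReal.ofReal m.γ ^ t * c t
              + ENNReal.ofReal m.γ ^ T * (c T + ENNReal.ofReal m.γ * e (T + 1)) := by ring
          _ ≤ ∑ t ∈ Finset.range T, ENNReal.ofReal m.γ ^ t * c t
              + ENNReal.ofReal m.γ ^ T * (e T + b) := 
            add_le_add le_rfl (mul_le_mul le_rfl (hstep T) zero_le zero_le)
          _ = (∑ t ∈ Finset.range T, ENNReal.ofReal m.γ ^ t * c t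
              + ENNReal.ofReal m.γ ^ T * e T) + ENNReal.ofReal m.γ ^ T * b := by ring
          _ ≤ _ := by rw [← add_assoc]; gcongr
    have hle : ∑' t, ENNReal.ofReal m.γ ^ t * c t
        ≤ e 0 + (∑' t : ℕ, ENNReal.ofReal m.γ ^ t) * b := by
      rw [ENNReal.tsum_eq_iSup_nat]
      refine iSup_le fun T ↦ (le_self_add.trans (hind T)).trans ?_
      rw [← ENNReal.tsum_mul_right]
      gcongr
      exact ENNReal.sum_le_tsum _
    refine ne_top_of_le_ne_top ?_ hle
    rw [he, expectedSq_zero]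
    finiteness
  · rw [gainPart_eq m ν _ x hγ0]
    simp only [hgain, lintegral_const, measure_univ, mul_one]
    rw [ENNReal.tsum_mul_right]
    exact ENNReal.mul_ne_top hgeo hHt

lemma value_optPolicy (hν : IsWhiteNoise ν) (hQ : 0 < m.Q) (hR : m.R.PosDef) (hγ0 : 0 < m.γ)
    (hγ1 : m.γ < 1) (hτ : 0 < m.τ) {P : ℝ} (hP : 0 < P) (hARE : m.SolvesARE P) (x : ℝ) :
    m.value ν (m.optPolicy P) x = ((P * x ^ 2 + m.optConst P : ℝ) : EReal) := by
  obtain ⟨hc, hg⟩ := finite_optPolicy hν hQ hR hγ0 hγ1 hτ hP hARE x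
  have h := (hasSum_bellmanGap hν hQ hR hγ0 hγ1 hτ hP hARE hc hg).2
  simp only [bellmanGap_optPolicy hQ hR hγ0 hγ1 hτ hP hARE, lintegral_zero, ENNReal.toReal_zero,
    mul_zero] at h
  rw [value_eq_coe m ν _ x hc hg]
  congr 1
  have := h.unique hasSum_zero
  linarith

lemma le_value (hν : IsWhiteNoise ν) (hQ : 0 < m.Q) (hR : m.R.PosDef) (hγ0 : 0 < m.γ)
    (hγ1 : m.γ < 1) (hτ : 0 < m.τ) {P : ℝ} (hP : 0 < P) (hARE : m.SolvesARE P) (π : Policy n)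
    (x : ℝ) : ((P * x ^ 2 + m.optConst P : ℝ) : EReal) ≤ m.value ν π x := by
  by_cases hfin : m.costPart ν π x ≠ ⊤ ∧ m.gainPart ν π x ≠ ⊤
  · rw [value_eq_coe m ν π x hfin.1 hfin.2, EReal.coe_le_coe_iff]
    have h := (hasSum_bellmanGap hν hQ hR hγ0 hγ1 hτ hP hARE hfin.1 hfin.2).2
    have := h.nonneg fun t ↦ by positivity
    linarith
  · rw [value_eq_top_of_not m ν π x hfin]
    exact le_top

lemma apply_eq_of_value_eq (hν : IsWhiteNoise ν) (hQ : 0 < m.Q) (hR : m.R.PosDef) (hγ0 : 0 < m.γ)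
    (hγ1 : m.γ < 1) (hτ : 0 < m.τ) {P : ℝ} (hP : 0 < P) (hARE : m.SolvesARE P) (π : Policy n)
    (x : ℝ) (hv : m.value ν π x = ((P * x ^ 2 + m.optConst P : ℝ) : EReal)) :
    π.1 x = multivariateGaussian (m.optMean P x) (m.optCov P) := by
  have hfin : m.costPart ν π x ≠ ⊤ ∧ m.gainPart ν π x ≠ ⊤ := by
    by_contra h
    rw [value_eq_top_of_not m ν π x h] at hv
    exact EReal.coe_ne_top _ hv.symm
  obtain ⟨hd, h⟩ := hasSum_bellmanGap hν hQ hR hγ0 hγ1 hτ hP hARE hfin.1 hfin.2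
  rw [value_eq_coe m ν π x hfin.1 hfin.2, EReal.coe_eq_coe_iff] at hv
  rw [hv, sub_self] at h
  -- A vanishing sum of nonnegative terms has zero term at `t = 0`, and the state law there is the
  -- Dirac mass at `x`, so the gap vanishes at the point `x`.
  have hgap : m.bellmanGap π P x = 0 := by
    have h0 := congrFun ((hasSum_zero_iff_of_nonneg fun t ↦ by positivity).1 h) 0
    simp only [pow_zero, one_mul, Pi.zero_apply] at h0
    have h1 := (ENNReal.toReal_eq_zero_iff _).1 h0
    rw [or_iff_left (hd 0), stateLaw_zero, lintegral_dirac' _ (m.measurable_bellmanGap π P)] at h1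
    exact h1
  have hc : m.stageCost (π.1 x) x ≠ ⊤ := fun htop ↦ by
    have := ENNReal.ne_top_of_tsum_ne_top (costPart_eq m ν π x hγ0 ▸ hfin.1) 0
    rw [stateLaw_zero, lintegral_dirac' _ (m.measurable_stageCost π), htop] at this
    simp at this
  have hg : m.stageGain (π.1 x) ≠ ⊤ := fun htop ↦ by
    have := ENNReal.ne_top_of_tsum_ne_top (gainPart_eq m ν π x hγ0 ▸ hfin.2) 0
    rw [stateLaw_zero, lintegral_dirac' _ (m.measurable_stageGain π), htop] at this
    simp at this
  exact (bellmanValue_le hQ hR hγ0 hγ1 hτ hP hARE hc hg).2.2 (tsub_eq_zero_iff_le.1 hgap)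

end Model
end EntropyLQ

theorem theorem1 {n : ℕ} (m : EntropyLQ.Model n)
    (hQ : 0 < m.Q) (hR : m.R.PosDef) (hγ0 : 0 < m.γ) (hγ1 : m.γ < 1) (hτ : 0 < m.τ)
    (ν : ℕ → Measure (EntropyLQ.Noise n)) [∀ t, IsProbabilityMeasure (ν t)]
    (hν : EntropyLQ.IsWhiteNoise ν)
    (hstab : ∃ K : Fin n → ℝ, m.γ * m.secondMomentFactor K < 1) :
    (∃ P : ℝ, 0 < P ∧ m.SolvesARE P) ∧
    ∀ P : ℝ, 0 < P → m.SolvesARE P →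
      (m.optCov P).PosDef ∧
      (∀ x : ℝ, m.optValue ν x = ((P * x ^ 2 + m.optConst P : ℝ) : EReal)) ∧
      ∃ πopt : EntropyLQ.Policy n,
        (∀ x : ℝ, πopt.1 x
          = multivariateGaussian (WithLp.toLp 2 (-(x • m.optGain P))) (m.optCov P)) ∧
        (∀ π : EntropyLQ.Policy n, (∀ x : ℝ, m.value ν π x = m.optValue ν x) ↔ π = πopt) ∧
        (∀ (ρ : Measure ℝ) [IsProbabilityMeasure ρ] (π : EntropyLQ.Policy n),
          m.objective ν ρ πopt ≤ m.objective ν ρ π) := by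
  refine ⟨m.exists_solvesARE hQ hR hγ0 hstab, fun P hP hARE ↦ ?_⟩
  have hle := EntropyLQ.Model.le_value hν hQ hR hγ0 hγ1 hτ hP hARE
  have hopt := EntropyLQ.Model.value_optPolicy hν hQ hR hγ0 hγ1 hτ hP hARE
  have hval : ∀ x : ℝ, m.optValue ν x = ((P * x ^ 2 + m.optConst P : ℝ) : EReal) := fun x ↦
    le_antisymm ((iInf_le _ (m.optPolicy P)).trans (hopt x).le) (le_iInf fun π ↦ hle π x)
  refine ⟨m.optCov_posDef hR hτ (by positivity), hval, m.optPolicy P, m.optPolicy_apply P,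
    fun π ↦ ⟨fun h ↦ ?_, ?_⟩, fun ρ _ π ↦ ?_⟩
  · refine Subtype.ext (Kernel.ext fun x ↦ ?_)
    rw [m.optPolicy_apply]
    exact EntropyLQ.Model.apply_eq_of_value_eq hν hQ hR hγ0 hγ1 hτ hP hARE π x
      ((h x).trans (hval x))
  · rintro rfl x
    rw [hopt, hval]
  · have h : ∀ x, m.value ν (m.optPolicy P) x ≤ m.value ν π x := fun x ↦
      (hopt x).le.trans (hle π x)
    -- The integrals of positive and negative parts are compared separately, so the inequality holds
    -- even when they are infinite.
    refine EReal.sub_le_sub ?_ ?_ <;> refine EReal.coe_ennreal_le_coe_ennreal_iff.2 ?_ <;>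
      refine lintegral_mono fun x ↦ EReal.toENNReal_le_toENNReal ?_
    · exact h x
    · exact EReal.neg_le_neg_iff.2 (h x)
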